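/- Let $d\ge 1$, let $P$ be the law of $(X,Y)\in[0,1]^d\times\{0,1\}$, let $\Pi$ be the law of $X$, $\eta(x)=P(Y=1\mid X=x)$, $R(g)=P(g(X)\ne Y)$ for $g:[0,1]^d\to\{0,1\}$, and $g^*=\mathbf 1_{\{\eta\ge 1/2\}}$. For a function $h$ write $f_h=\max(h,1-h)$. Assume, for constants $s\ge 0$ and $\mu_{\min},\mu_{\max},C>0$: (1) $|\eta(x)-\eta(z)|\le s\|x-z\|_\infty$ for all $x,z\in[0,1]^d$; (2) $\Pi$ has a density $p_X$ on $[0,1]^d$ with $\mu_{\min}\le p_X\le\mu_{\max}$ on $[0,1]^d$; (3) $f_\eta(X)$ has a density bounded by $C$. *Parameters.* Let $N\ge 1$ be the label budget, $\delta\in(0,\tfrac12)$ and $c_N>1$. Put $N_0=\lfloor\sqrt N\rfloor$, $N_{k+1}=\lfloor c_N N_k\rfloor$, $r_k=N_k^{-1/(d+2)}$, $\varepsilon_0=1$ and, for $k\ge 1$, $$\varepsilon_k=\min\Big(1,\ \log\big(\tfrac N\delta\big)\log(N)\,N_{k-1}^{-1/(2+d)}\Big).$$ Let $\mathcal C_k$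 ($k\ge 0$) be the partition of $[0,1]^d$ into $m_k^d$ cubes of edge length $1/m_k$, where $m_k$ is a positive integer, $m_k$ divides $m_{k+1}$ (each partition refines the previous one), and $r_k/\kappa\le 1/m_k\le\kappa r_k$ for a constant $\kappa\ge 1$ (rounding the bandwidth $r_k$ to a power of $2$ gives such partitions with $\kappa=2$). *Algorithm.* Put $A_0=[0,1]^d$. At step $k\ge 0$, set $n_k=\lfloor N_k\Pi(A_k)\rfloor$ and, conditionally on the data of the earlier steps, draw i.i.d. pairs $(X_j,Y_j)_{j\le n_k}$ from the law of $(X,Y)$ conditioned on $X\in A_k$. The histogram estimator is $$\hat\eta_k(x)=\frac{\Pi(A_k)}{\Pi(R)}\,\frac1{n_k}\sum_{j=1}^{n_k}Y_j\mathbf 1_{\{X_j\in R\}},\qquad x\in R\in\mathcal C_k .$$ The next uncertain region is $$A_{k+1}=\{x\in A_k:\ f_{\hat\eta_k}(x)\le\lambda_{k+1}\},\qquad \lambda_{k+1}=\sup\{t:\ \Pi(\{f_{\hat\eta_k}\le t\}\cap A_k)\le\varepsilon_{k+1}\}.$$ The algorithm stops at the last step $L$ with $n_0+\dots+n_L\le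 N$, and returns $\hat g=\mathbf 1_{\{\hat\eta\ge 1/2\}}$ with $$\hat\eta=\sum_{j=0}^{L-1}\hat\eta_j\mathbf 1_{A_j\setminus A_{j+1}}+\hat\eta_L\mathbf 1_{A_L}.$$ **Theorem.** There are constants $K>0$ and $p\in\mathbb N$, depending only on $d,s,\mu_{\min},\mu_{\max},C,c_N,\kappa$, such that for all $N\ge 1$, all $\delta\in(0,\tfrac12)$ and all $P$ and $(m_k)$ as above, with probability at least $1-\delta$, $$R(\hat g)-R(g^*)\ \le\ K\,\log^p\!\big(\tfrac N\delta\big)\,N^{-\frac{2}{1+d}} .$$ -/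

import Mathlib

open MeasureTheory Set

noncomputable section

/-- The instance space `[0,1]^d`, inside `Fin d → ℝ` (which carries the sup norm). -/
def unitCube (d : ℕ) : Set (Fin d → ℝ) := Set.Icc 0 1

/-! ### The classification problem -/

/-- `η` is a version of the regression function `x ↦ P(Y = 1 | X = x)` on the cube, where `P` is the
law of the pair `(X, Y)` and the labels `1`, `0` are `true`, `false`. -/
structure IsRegressionFunction {d : ℕ} (P : Measure ((Fin d → ℝ) × Bool)) (η : (Fin d → ℝ) → ℝ) :
    Prop where
  mem_Icc : ∀ x ∈ unitCube d, η x ∈ Set.Icc (0 : ℝ) 1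
  aemeasurable : AEMeasurable η P.fst
  setLIntegral_eq : ∀ A : Set (Fin d → ℝ), MeasurableSet A →
    P (A ×ˢ {true}) = ∫⁻ x in A, ENNReal.ofReal (η x) ∂P.fst

/-- The score function `max(η, 1 - η)`. -/
def score {d : ℕ} (η : (Fin d → ℝ) → ℝ) (x : Fin d → ℝ) : ℝ := max (η x) (1 - η x)

/-- The plug-in classifier `1_{η ≥ 1/2}`. -/
def plugIn {d : ℕ} (η : (Fin d → ℝ) → ℝ) (x : Fin d → ℝ) : Bool :=
  open Classical in decide (1 / 2 ≤ η x)

/-- The misclassification risk `R(g) = P(g(X) ≠ Y)`. -/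
def risk {d : ℕ} (P : Measure ((Fin d → ℝ) × Bool)) (g : (Fin d → ℝ) → Bool) : ℝ :=
  P.real {z | g z.1 ≠ z.2}

/-- Smoothness: `η` is `s`-Lipschitz on the cube for the sup norm. -/
def IsSmooth {d : ℕ} (s : ℝ) (η : (Fin d → ℝ) → ℝ) : Prop :=
  ∀ x ∈ unitCube d, ∀ z ∈ unitCube d, |η x - η z| ≤ s * ‖x - z‖

/-- Strong density: `Π` has a density on the cube with values in `[μmin, μmax]`. -/
def HasStrongDensity {d : ℕ} (μmin μmax : ℝ) (Pi : Measure (Fin d → ℝ)) : Prop :=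
  ∃ p : (Fin d → ℝ) → ℝ, Measurable p ∧
    Pi = (volume.restrict (unitCube d)).withDensity (fun x => ENNReal.ofReal (p x)) ∧
    ∀ x ∈ unitCube d, μmin ≤ p x ∧ p x ≤ μmax

/-- Score regularity: the law of `f(X)`, for `X` of law `Π`, has a density bounded by `C`. -/
def HasBoundedScoreDensity {d : ℕ} (C : ℝ) (Pi : Measure (Fin d → ℝ)) (f : (Fin d → ℝ) → ℝ) :
    Prop :=
  ∃ q : ℝ → ℝ, Measurable q ∧ (∀ t, 0 ≤ q t ∧ q t ≤ C) ∧
    Pi.map f = volume.withDensity (fun t => ENNReal.ofReal (q t))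

/-! ### Cubic partitions and the histogram rule -/

/-- Coordinates of the cell containing `x` in the partition of `[0,1]^d` into `m^d` cubes of edge
length `1/m` (half-open, except at the upper faces of the cube). -/
def gridIndex {d : ℕ} (m : ℕ) (x : Fin d → ℝ) (i : Fin d) : ℕ := min ⌊(m : ℝ) * x i⌋₊ (m - 1)

/-- The cell containing `x` of the cubic partition with edge length `1/m`. -/
def gridCell {d : ℕ} (m : ℕ) (x : Fin d → ℝ) : Set (Fin d → ℝ) :=
  {z | z ∈ unitCube d ∧ ∀ i, gridIndex m z i = gridIndex m x i}

/-- The histogram rule on `A` with edge length `1/m`, computed from the first `n` terms of the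
labelled sample `D`: on a cell `R` it is `(Π(A) / Π(R)) * (1/n) * ∑_j Y_j 1_{X_j ∈ R}`. -/
def histogram {d : ℕ} (Pi : Measure (Fin d → ℝ)) (A : Set (Fin d → ℝ)) (n m : ℕ)
    (D : ℕ → (Fin d → ℝ) × Bool) (x : Fin d → ℝ) : ℝ :=
  Pi.real A / Pi.real (gridCell m x) *
    ((1 / (n : ℝ)) * ∑ j ∈ Finset.range n,
      (if (D j).2 then (1 : ℝ) else 0) * (gridCell m x).indicator (fun _ => (1 : ℝ)) (D j).1)

/-! ### The algorithm, as a function of the data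

`P` is the law of `(X, Y)` (only its marginal `P.fst` is used by the algorithm), `N` the label
budget, `1 - δ` the confidence level, `cN` the growth factor, `m k` the number of subdivisions of
each side of the cube at step `k`, and `D k i` the `i`-th labelled point drawn at step `k`. -/

/-- `N_0 = ⌊√N⌋` and `N_{k+1} = ⌊cN * N_k⌋`. -/
def stepSize (cN : ℝ) (N : ℕ) : ℕ → ℕ
  | 0 => Nat.sqrt N
  | k + 1 => ⌊cN * (stepSize cN N k : ℝ)⌋₊

/-- The bandwidth `r_k = N_k^{-1/(d+2)}`. -/
def bandwidth (d : ℕ) (cN : ℝ) (N k : ℕ) : ℝ :=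
  (stepSize cN N k : ℝ) ^ (-(1 / ((d : ℝ) + 2)))

/-- The rejection rates: `ε_0 = 1` and
`ε_{k+1} = min(1, log(N/δ) * log N * N_k^{-1/(2+d)})`. -/
def rejectionRate (d : ℕ) (cN : ℝ) (N : ℕ) (δ : ℝ) : ℕ → ℝ
  | 0 => 1
  | k + 1 => min 1 (Real.log ((N : ℝ) / δ) * Real.log (N : ℝ) *
      (stepSize cN N k : ℝ) ^ (-(1 / (2 + (d : ℝ)))))

/-- Number of labels requested at a step with parameter `Nk` and uncertain region `A`:
`⌊Nk * Π(A)⌋`. -/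
def labelCount {d : ℕ} (Pi : Measure (Fin d → ℝ)) (Nk : ℕ) (A : Set (Fin d → ℝ)) : ℕ :=
  ⌊(Nk : ℝ) * Pi.real A⌋₊

/-- The threshold for the score `f` on `A` at rejection rate `ε`: the supremum of all `t` with
`Π({f ≤ t} ∩ A) ≤ ε`; it is `⊤` if `Π(A) ≤ ε`. -/
def threshold {d : ℕ} (Pi : Measure (Fin d → ℝ)) (A : Set (Fin d → ℝ)) (f : (Fin d → ℝ) → ℝ)
    (ε : ℝ) : EReal :=
  sSup {t : EReal | Pi.real {x | x ∈ A ∧ (f x : EReal) ≤ t} ≤ ε}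

/-- The uncertain regions: `A_0 = [0,1]^d` and `A_{k+1} = {x ∈ A_k | f̂_k(x) ≤ λ_{k+1}}`, where
`f̂_k` is the score of the histogram rule on `A_k`. -/
def region {d : ℕ} (P : Measure ((Fin d → ℝ) × Bool)) (N : ℕ) (δ cN : ℝ) (m : ℕ → ℕ)
    (D : ℕ → ℕ → (Fin d → ℝ) × Bool) : ℕ → Set (Fin d → ℝ)
  | 0 => unitCube d
  | k + 1 =>
    let A := region P N δ cN m D k
    let f := score (histogram P.fst A (labelCount P.fst (stepSize cN N k) A) (m k) (D k))
    {x | x ∈ A ∧ (f x : EReal) ≤ threshold P.fst A f (rejectionRate d cN N δ (k + 1))}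

/-- The estimator `η̂_k`: the histogram rule on `A_k` from `⌊N_k Π(A_k)⌋` labelled points. -/
def stepEstimator {d : ℕ} (P : Measure ((Fin d → ℝ) × Bool)) (N : ℕ) (δ cN : ℝ) (m : ℕ → ℕ)
    (D : ℕ → ℕ → (Fin d → ℝ) × Bool) (k : ℕ) : (Fin d → ℝ) → ℝ :=
  histogram P.fst (region P N δ cN m D k)
    (labelCount P.fst (stepSize cN N k) (region P N δ cN m D k)) (m k) (D k)

/-- Number of labels requested up to and including step `k`. -/
def labelsUsed {d : ℕ} (P : Measure ((Fin d → ℝ) × Bool)) (N : ℕ) (δ cN : ℝ) (m : ℕ → ℕ)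
    (D : ℕ → ℕ → (Fin d → ℝ) × Bool) (k : ℕ) : ℕ :=
  ∑ j ∈ Finset.range (k + 1), labelCount P.fst (stepSize cN N j) (region P N δ cN m D j)

/-- The last step `L` that the budget `N` allows (`labelsUsed` is nondecreasing in the step). -/
def lastStep {d : ℕ} (P : Measure ((Fin d → ℝ) × Bool)) (N : ℕ) (δ cN : ℝ) (m : ℕ → ℕ)
    (D : ℕ → ℕ → (Fin d → ℝ) × Bool) : ℕ :=
  sSup {k | labelsUsed P N δ cN m D k ≤ N}

/-- `η̂ = ∑_{j < L} η̂_j 1_{A_j \ A_{j+1}} + η̂_L 1_{A_L}`. -/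
def finalEstimator {d : ℕ} (P : Measure ((Fin d → ℝ) × Bool)) (N : ℕ) (δ cN : ℝ) (m : ℕ → ℕ)
    (D : ℕ → ℕ → (Fin d → ℝ) × Bool) (x : Fin d → ℝ) : ℝ :=
  (∑ j ∈ Finset.range (lastStep P N δ cN m D),
    (region P N δ cN m D j \ region P N δ cN m D (j + 1)).indicator
      (stepEstimator P N δ cN m D j) x) +
  (region P N δ cN m D (lastStep P N δ cN m D)).indicator
    (stepEstimator P N δ cN m D (lastStep P N δ cN m D)) x

/-- The classifier returned by the algorithm. -/
def activeClassifier {d : ℕ} (P : Measure ((Fin d → ℝ) × Bool)) (N : ℕ) (δ cN : ℝ) (m : ℕ → ℕ)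
    (D : ℕ → ℕ → (Fin d → ℝ) × Bool) : (Fin d → ℝ) → Bool :=
  plugIn (finalEstimator P N δ cN m D)

/-! ### Active sampling -/

/-- The σ-algebra generated by the data of all steps before step `k`. -/
abbrev pastData {Ω S : Type*} [MeasurableSpace S] (Z : ℕ → ℕ → Ω → S) (k : ℕ) : MeasurableSpace Ω :=
  ⨆ j : ℕ, ⨆ _ : j < k, ⨆ i : ℕ, MeasurableSpace.comap (Z j i) inferInstance

/-- Active sampling: conditionally on the data of the steps before step `k`, the labelled points
`Z k 0, Z k 1, …` are i.i.d. with the law of `(X, Y)` conditioned on `X ∈ A k`; that is, `X` has law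
`Π(· | A k)` and, given `X`, `Y` is Bernoulli of parameter `η(X)`. The sequence at each step is an
infinite supply, of which the algorithm uses finitely many terms. -/
structure IsActiveSample {d : ℕ} {Ω : Type*} [MeasurableSpace Ω] (μ : Measure Ω)
    (P : Measure ((Fin d → ℝ) × Bool)) (A : ℕ → Ω → Set (Fin d → ℝ))
    (Z : ℕ → ℕ → Ω → (Fin d → ℝ) × Bool) : Prop where
  measurable : ∀ k i, Measurable (Z k i)
  cond_law : ∀ (k : ℕ) (S : Set Ω), MeasurableSet[pastData Z k] S →
    ∀ (n : ℕ) (T : Fin n → Set ((Fin d → ℝ) × Bool)), (∀ i, MeasurableSet (T i)) →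
      μ (S ∩ {ω | ∀ i : Fin n, Z k i ω ∈ T i}) =
        ∫⁻ ω in S, ∏ i : Fin n, ProbabilityTheory.cond P (A k ω ×ˢ Set.univ) (T i) ∂μ

end

/-!
At step `k` a cell of `𝒞_k` receives at least about `r_k^{-2}` points on average, whatever the
uncertain region is, as long as the region is a union of cells of mass at least `r_k`. The Chernoff
bound, applied conditionally on the past, and the Lipschitz bias then give, on one event of
probability `1 - δ`, an error `|η̂_k - η| ≤ Δ_k ≍ log(N/δ) r_k` on `A_k` for every `k` with
`N_k ≤ N²`.

On this event two things follow from the score density, since `ε_{k+1}` dominates `Δ_k` for large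
`N`. A point leaving the region at step `k` is already classified as by `η`: otherwise its
estimated score would be within `Δ_k` of `1/2`, and too little mass would lie below the threshold.
And `Π(A_{k+1}) ≲ log(N/δ) log(N) r_k`, so that step `k + 1` costs about `N_k r_k` labels; when the
budget runs out after step `L`, this forces `N ≲ log³(N/δ) N_L r_L = log³(N/δ) r_L^{-(d+1)}`.

Hence the classifier errs only where `|η - 1/2| ≤ Δ_L`. That set has mass of order `Δ_L`, so the
excess risk is of order `Δ_L² ≍ log²(N/δ) r_L² ≲ log⁵(N/δ) N^{-2/(d+1)}`.
-/

/-! ### Cubic partitions -/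

section Grid

variable {d m : ℕ} {x z : Fin d → ℝ}

lemma measurableSet_unitCube : MeasurableSet (unitCube d) := measurableSet_Icc

lemma measurable_gridIndex (m : ℕ) : Measurable (gridIndex (d := d) m) :=
  measurable_pi_lambda _ fun i =>
    (Nat.measurable_floor.comp (measurable_const.mul (measurable_pi_apply i))).min measurable_const

lemma gridIndex_lt (hm : 0 < m) (x : Fin d → ℝ) (i : Fin d) : gridIndex m x i < m :=
  (min_le_right _ _).trans_lt (Nat.sub_lt hm one_pos)

lemma mul_mem_Icc_gridIndex (hm : 0 < m) (hx : x ∈ unitCube d) (i : Fin d) :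
    (m : ℝ) * x i ∈ Icc (gridIndex m x i : ℝ) (gridIndex m x i + 1) := by
  have hmx : 0 ≤ (m : ℝ) * x i := mul_nonneg m.cast_nonneg (hx.1 i)
  refine ⟨(Nat.cast_le.2 (min_le_left _ _)).trans (Nat.floor_le hmx), ?_⟩
  rcases le_total ⌊(m : ℝ) * x i⌋₊ (m - 1) with h | h
  · rw [gridIndex, min_eq_left h]
    exact (Nat.lt_floor_add_one _).le
  · rw [gridIndex, min_eq_right h, Nat.cast_pred hm, sub_add_cancel]
    exact mul_le_of_le_one_right m.cast_nonneg (hx.2 i)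

lemma gridIndex_eq_div_of_dvd {m' : ℕ} (h : m ∣ m') (hm' : 0 < m') (z : Fin d → ℝ) (i : Fin d) :
    gridIndex m z i = gridIndex m' z i / (m' / m) := by
  obtain ⟨q, rfl⟩ := h
  have hm : 0 < m := Nat.pos_of_mul_pos_right hm'
  have hq : 0 < q := Nat.pos_of_mul_pos_left hm'
  have hfloor : ⌊(m : ℝ) * z i⌋₊ = ⌊((m * q : ℕ) : ℝ) * z i⌋₊ / q := by
    rw [← Nat.floor_div_natCast]
    congr 1
    push_cast
    field_simp
  have hlast : m - 1 = (m * q - 1) / q := by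
    rw [mul_comm m q, Nat.mul_sub_div 0 q m (by positivity), Nat.zero_div, zero_add]
  rw [Nat.mul_div_cancel_left q hm, gridIndex, gridIndex, hfloor, hlast]
  exact (Monotone.map_min fun a b hab => Nat.div_le_div_right hab).symm

/-- The cell of index `v` of the partition of the cube with edge length `1 / m`, so that
`gridCell m x = cellOf m (gridIndex m x)`. There are only countably many of them. -/
def cellOf (m : ℕ) (v : Fin d → ℕ) : Set (Fin d → ℝ) := unitCube d ∩ gridIndex m ⁻¹' {v}

lemma gridCell_eq_cellOf (m : ℕ) (x : Fin d → ℝ) : gridCell m x = cellOf m (gridIndex m x) := by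
  ext z
  simp [gridCell, cellOf, funext_iff]

lemma measurableSet_cellOf (m : ℕ) (v : Fin d → ℕ) : MeasurableSet (cellOf m v) :=
  measurableSet_unitCube.inter (measurable_gridIndex m (measurableSet_singleton v))

lemma measurableSet_gridCell (m : ℕ) (x : Fin d → ℝ) : MeasurableSet (gridCell m x) :=
  gridCell_eq_cellOf m x ▸ measurableSet_cellOf m _

lemma gridCell_subset_unitCube (m : ℕ) (x : Fin d → ℝ) : gridCell m x ⊆ unitCube d :=
  fun _ hz => hz.1

lemma gridCell_eq_of_mem (hz : z ∈ gridCell m x) : gridCell m z = gridCell m x := by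
  rw [gridCell_eq_cellOf, gridCell_eq_cellOf, show gridIndex m z = gridIndex m x from funext hz.2]

lemma gridCell_anti {m' : ℕ} (h : m ∣ m') (hm' : 0 < m') (x : Fin d → ℝ) :
    gridCell m' x ⊆ gridCell m x := by
  rintro z ⟨hz, hi⟩
  refine ⟨hz, fun i => ?_⟩
  rw [gridIndex_eq_div_of_dvd h hm', gridIndex_eq_div_of_dvd h hm', hi i]

lemma norm_sub_le_of_mem_gridCell (hm : 0 < m) (hx : x ∈ unitCube d) (hz : z ∈ gridCell m x) :
    ‖z - x‖ ≤ 1 / m := by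
  have hmR : (0 : ℝ) < m := Nat.cast_pos.2 hm
  refine (pi_norm_le_iff_of_nonneg (by positivity)).2 fun i => ?_
  have hxi := mul_mem_Icc_gridIndex hm hx i
  have hzi := mul_mem_Icc_gridIndex hm hz.1 i
  rw [hz.2 i] at hzi
  rw [Pi.sub_apply, Real.norm_eq_abs, le_div_iff₀ hmR, ← abs_of_pos hmR, ← abs_mul, abs_le]
  constructor <;> nlinarith [hxi.1, hxi.2, hzi.1, hzi.2]

lemma pi_Ico_subset_gridCell (hm : 0 < m) (x : Fin d → ℝ) :
    (univ.pi fun i => Ico ((gridIndex m x i : ℝ) / m) ((gridIndex m x i + 1 : ℝ) / m)) ⊆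
      gridCell m x := by
  have hmR : (0 : ℝ) < m := Nat.cast_pos.2 hm
  intro z hz
  have hlo : ∀ i, (gridIndex m x i : ℝ) ≤ m * z i := fun i =>
    (div_le_iff₀' hmR).1 (hz i (mem_univ i)).1
  have hhi : ∀ i, m * z i < (gridIndex m x i : ℝ) + 1 := fun i =>
    (lt_div_iff₀' hmR).1 (hz i (mem_univ i)).2
  have hle : ∀ i, (gridIndex m x i : ℝ) + 1 ≤ m := fun i => by exact_mod_cast gridIndex_lt hm x i
  have hmz : ∀ i, 0 ≤ (m : ℝ) * z i := fun i => (Nat.cast_nonneg _).trans (hlo i)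
  refine ⟨⟨fun i => nonneg_of_mul_nonneg_right (hmz i) hmR, fun i => ?_⟩, fun i => ?_⟩
  · exact le_of_mul_le_mul_left (by simpa using (hhi i).le.trans (hle i)) hmR
  · have hfloor : ⌊(m : ℝ) * z i⌋₊ = gridIndex m x i :=
      (Nat.floor_eq_iff (hmz i)).2 ⟨hlo i, hhi i⟩
    rw [gridIndex, hfloor, min_eq_left (Nat.le_sub_one_of_lt (gridIndex_lt hm x i))]

lemma le_volume_gridCell (hm : 0 < m) (x : Fin d → ℝ) :
    ENNReal.ofReal ((1 / (m : ℝ)) ^ d) ≤ volume (gridCell m x) :=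
  calc ENNReal.ofReal ((1 / (m : ℝ)) ^ d)
      = volume (univ.pi fun i =>
          Ico ((gridIndex m x i : ℝ) / m) ((gridIndex m x i + 1 : ℝ) / m)) := by
        simp only [Real.volume_pi_Ico, ← sub_div, add_sub_cancel_left, Finset.prod_const,
          Finset.card_univ, Fintype.card_fin]
        exact ENNReal.ofReal_pow (by positivity) d
    _ ≤ volume (gridCell m x) := measure_mono (pi_Ico_subset_gridCell hm x)

lemma exists_finset_gridCell_eq (hm : 0 < m) :
    ∃ F : Finset (Fin d → ℝ), F.card ≤ m ^ d ∧ ∀ x, ∃ y ∈ F, gridCell m y = gridCell m x := by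
  refine ⟨(Fintype.piFinset fun _ => Finset.range m).image (Function.invFun (gridIndex m)),
    Finset.card_image_le.trans_eq (by simp), fun x =>
      ⟨Function.invFun (gridIndex m) (gridIndex m x), Finset.mem_image_of_mem _ ?_, ?_⟩⟩
  · simpa only [Fintype.mem_piFinset, Finset.mem_range] using gridIndex_lt hm x
  · rw [gridCell_eq_cellOf, gridCell_eq_cellOf, Function.invFun_eq (f := gridIndex m) ⟨x, rfl⟩]

lemma histogram_eq_of_mem (hz : z ∈ gridCell m x) (Pi : Measure (Fin d → ℝ))
    (A : Set (Fin d → ℝ)) (n : ℕ) (D : ℕ → (Fin d → ℝ) × Bool) :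
    histogram Pi A n m D z = histogram Pi A n m D x := by
  rw [histogram, histogram, gridCell_eq_of_mem hz]

lemma measurable_histogram (Pi : Measure (Fin d → ℝ)) (A : Set (Fin d → ℝ)) (n m : ℕ)
    (D : ℕ → (Fin d → ℝ) × Bool) : Measurable (histogram Pi A n m D) := by
  let byIndex (v : Fin d → ℕ) : ℝ := Pi.real A / Pi.real (cellOf m v) *
    ((1 / (n : ℝ)) * ∑ j ∈ Finset.range n,
      (if (D j).2 then (1 : ℝ) else 0) * (cellOf m v).indicator (fun _ => (1 : ℝ)) (D j).1)
  have hcomp : histogram Pi A n m D = byIndex ∘ gridIndex m := by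
    ext x
    simp only [histogram, gridCell_eq_cellOf, Function.comp, byIndex]
  exact hcomp ▸ Measurable.of_discrete.comp (measurable_gridIndex m)

/-- `A` is a union of cells of the partition of the cube with edge length `1 / m`; the uncertain
regions of the algorithm have this form. -/
structure IsCellUnion (m : ℕ) (A : Set (Fin d → ℝ)) : Prop where
  subset : A ⊆ unitCube d
  gridCell_subset : ∀ x ∈ A, gridCell m x ⊆ A

namespace IsCellUnion

variable {A : Set (Fin d → ℝ)}

lemma unitCube (m : ℕ) : IsCellUnion m (unitCube d) := ⟨subset_rfl, fun _ _ _ hz => hz.1⟩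

lemma of_dvd {m' : ℕ} (hA : IsCellUnion m A) (h : m ∣ m') (hm' : 0 < m') : IsCellUnion m' A :=
  ⟨hA.subset, fun x hx => (gridCell_anti h hm' x).trans (hA.gridCell_subset x hx)⟩

lemma eq_inter_preimage (hA : IsCellUnion m A) :
    A = _root_.unitCube d ∩ gridIndex m ⁻¹' (gridIndex m '' A) := by
  ext x
  constructor
  · exact fun hx => ⟨hA.subset hx, x, hx, rfl⟩
  · rintro ⟨hx, z, hz, hzx⟩
    exact hA.gridCell_subset z hz ⟨hx, fun i => congrFun hzx.symm i⟩

lemma measurableSet (hA : IsCellUnion m A) : MeasurableSet A := by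
  rw [hA.eq_inter_preimage]
  exact measurableSet_unitCube.inter (measurable_gridIndex m (Set.to_countable _).measurableSet)

end IsCellUnion

end Grid

/-! ### Thresholds -/

section Threshold

variable {d : ℕ} {Pi : Measure (Fin d → ℝ)} {A : Set (Fin d → ℝ)} {f : (Fin d → ℝ) → ℝ} {ε : ℝ}

lemma measurableSet_sublevel (hA : MeasurableSet A) (hf : Measurable f) (t : EReal) :
    MeasurableSet {x | x ∈ A ∧ (f x : EReal) ≤ t} :=
  hA.inter (measurableSet_le (measurable_coe_real_ereal.comp hf) measurable_const)

lemma lt_real_of_threshold_lt {t : EReal} (ht : threshold Pi A f ε < t) :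
    ε < Pi.real {x | x ∈ A ∧ (f x : EReal) ≤ t} :=
  not_le.1 fun h => ht.not_ge (le_sSup h)

lemma real_le_of_lt_threshold [IsFiniteMeasure Pi] {t : EReal} (ht : t < threshold Pi A f ε) :
    Pi.real {x | x ∈ A ∧ (f x : EReal) ≤ t} ≤ ε := by
  obtain ⟨s, hs, hts⟩ := lt_sSup_iff.1 ht
  refine (measureReal_mono ?_).trans hs
  exact fun x hx => ⟨hx.1, hx.2.trans hts.le⟩

lemma real_lt_threshold_le [IsFiniteMeasure Pi] (hε : 0 ≤ ε) :
    Pi.real {x | x ∈ A ∧ (f x : EReal) < threshold Pi A f ε} ≤ ε := by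
  rcases eq_bot_or_bot_lt (threshold Pi A f ε) with h | h
  · simp [h, hε]
  obtain ⟨u, hu, hmem, hlim⟩ := exists_seq_strictMono_tendsto' h
  have hunion : {x | x ∈ A ∧ (f x : EReal) < threshold Pi A f ε} =
      ⋃ n, {x | x ∈ A ∧ (f x : EReal) ≤ u n} := by
    ext x
    simp only [mem_ofPred_eq, mem_iUnion]
    constructor
    · rintro ⟨hx, hlt⟩
      obtain ⟨n, hn⟩ := (hlim.eventually (lt_mem_nhds hlt)).exists
      exact ⟨n, hx, hn.le⟩
    · rintro ⟨n, hx, hn⟩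
      exact ⟨hx, hn.trans_lt (hmem n).2⟩
  have hmono : Monotone fun n => {x | x ∈ A ∧ (f x : EReal) ≤ u n} :=
    fun a b hab x hx => ⟨hx.1, hx.2.trans (hu.monotone hab)⟩
  have htendsto := (ENNReal.tendsto_toReal (measure_ne_top Pi _)).comp
    (tendsto_measure_iUnion_atTop (μ := Pi) hmono)
  rw [← hunion] at htendsto
  exact le_of_tendsto' htendsto fun n => real_le_of_lt_threshold (hmem n).2

lemma min_le_real_le_threshold [IsFiniteMeasure Pi] (hA : MeasurableSet A) (hf : Measurable f) :
    min (Pi.real A) ε ≤ Pi.real {x | x ∈ A ∧ (f x : EReal) ≤ threshold Pi A f ε} := by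
  rcases eq_top_or_lt_top (threshold Pi A f ε) with h | h
  · simp [h]
  refine (min_le_right _ _).trans ?_
  obtain ⟨u, hu, hmem, hlim⟩ := exists_seq_strictAnti_tendsto' h
  have hinter : {x | x ∈ A ∧ (f x : EReal) ≤ threshold Pi A f ε} =
      ⋂ n, {x | x ∈ A ∧ (f x : EReal) ≤ u n} := by
    ext x
    simp only [mem_ofPred_eq, mem_iInter]
    constructor
    · rintro ⟨hx, hle⟩ n
      exact ⟨hx, hle.trans (hmem n).1.le⟩
    · exact fun hx => ⟨(hx 0).1, ge_of_tendsto' hlim fun n => (hx n).2⟩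
  have hanti : Antitone fun n => {x | x ∈ A ∧ (f x : EReal) ≤ u n} :=
    fun a b hab x hx => ⟨hx.1, hx.2.trans (hu.antitone hab)⟩
  have htendsto := (ENNReal.tendsto_toReal (measure_ne_top Pi _)).comp
    (tendsto_measure_iInter_atTop (μ := Pi)
      (fun n => (measurableSet_sublevel hA hf (u n)).nullMeasurableSet) hanti
      ⟨0, measure_ne_top _ _⟩)
  rw [← hinter] at htendsto
  exact ge_of_tendsto' htendsto fun n => (lt_real_of_threshold_lt (hmem n).1).le

end Threshold

/-! ### Densities, scores and risks -/

section Distribution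

variable {d : ℕ} {Pi : Measure (Fin d → ℝ)} {μmin : ℝ}

/-- The lower half of the strong density assumption, for a measure that need not have a density:
`Π` is carried by the cube and dominates `μmin` times Lebesgue measure there. -/
structure HasDensityLowerBound (μmin : ℝ) (Pi : Measure (Fin d → ℝ)) : Prop where
  measure_compl_unitCube : Pi (unitCube d)ᶜ = 0
  smul_restrict_le : ENNReal.ofReal μmin • volume.restrict (unitCube d) ≤ Pi

lemma HasStrongDensity.hasDensityLowerBound {μmax : ℝ} (h : HasStrongDensity μmin μmax Pi) :
    HasDensityLowerBound μmin Pi := by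
  obtain ⟨p, -, rfl, hp⟩ := h
  refine ⟨withDensity_absolutelyContinuous _ _ ?_, ?_⟩
  · simp [Measure.restrict_apply measurableSet_unitCube.compl]
  · rw [← withDensity_const]
    refine withDensity_mono ((ae_restrict_iff' measurableSet_unitCube).2 ?_)
    exact .of_forall fun x hx => ENNReal.ofReal_le_ofReal (hp x hx).1

namespace HasDensityLowerBound

lemma ae_mem_unitCube (h : HasDensityLowerBound μmin Pi) : ∀ᵐ x ∂Pi, x ∈ unitCube d :=
  h.measure_compl_unitCube

lemma real_unitCube [IsProbabilityMeasure Pi] (h : HasDensityLowerBound μmin Pi) :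
    Pi.real (unitCube d) = 1 := by
  rw [measureReal_def, prob_compl_eq_zero_iff measurableSet_unitCube |>.1
    h.measure_compl_unitCube, ENNReal.toReal_one]

lemma le_real_gridCell [IsFiniteMeasure Pi] (h : HasDensityLowerBound μmin Pi) (hμmin : 0 ≤ μmin)
    {m : ℕ} (hm : 0 < m) (x : Fin d → ℝ) :
    μmin * (1 / (m : ℝ)) ^ d ≤ Pi.real (gridCell m x) := by
  refine (ENNReal.ofReal_le_iff_le_toReal (measure_ne_top _ _)).1 ?_
  calc ENNReal.ofReal (μmin * (1 / (m : ℝ)) ^ d)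
      = ENNReal.ofReal μmin * ENNReal.ofReal ((1 / (m : ℝ)) ^ d) := ENNReal.ofReal_mul hμmin
    _ ≤ ENNReal.ofReal μmin * volume (gridCell m x) := by gcongr; exact le_volume_gridCell hm x
    _ = (ENNReal.ofReal μmin • volume.restrict (unitCube d)) (gridCell m x) := by
        rw [Measure.smul_apply, smul_eq_mul, Measure.restrict_eq_self _
          (gridCell_subset_unitCube m x)]
    _ ≤ Pi (gridCell m x) := h.smul_restrict_le _

end HasDensityLowerBound

lemma HasBoundedScoreDensity.nonneg {C : ℝ} {f : (Fin d → ℝ) → ℝ}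
    (h : HasBoundedScoreDensity C Pi f) : 0 ≤ C := by
  obtain ⟨q, -, hq, -⟩ := h
  exact (hq 0).1.trans (hq 0).2

lemma HasBoundedScoreDensity.real_mem_Icc_le {C : ℝ} {f : (Fin d → ℝ) → ℝ}
    (h : HasBoundedScoreDensity C Pi f) (hf : AEMeasurable f Pi) {a b : ℝ} (hab : a ≤ b) :
    Pi.real {x | f x ∈ Icc a b} ≤ C * (b - a) := by
  have hC := h.nonneg
  obtain ⟨q, -, hq, hmap⟩ := h
  refine ENNReal.toReal_le_of_le_ofReal (mul_nonneg hC (sub_nonneg.2 hab)) ?_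
  calc Pi {x | f x ∈ Icc a b} = Pi.map f (Icc a b) :=
        (Measure.map_apply_of_aemeasurable hf measurableSet_Icc).symm
    _ = ∫⁻ t in Icc a b, ENNReal.ofReal (q t) := by
        rw [hmap, withDensity_apply _ measurableSet_Icc]
    _ ≤ ∫⁻ _ in Icc a b, ENNReal.ofReal C :=
        setLIntegral_mono measurable_const fun t _ => ENNReal.ofReal_le_ofReal (hq t).2
    _ = ENNReal.ofReal (C * (b - a)) := by
        rw [setLIntegral_const, Real.volume_Icc, ENNReal.ofReal_mul hC]

section Score

variable {η η' : (Fin d → ℝ) → ℝ}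

lemma score_eq (η : (Fin d → ℝ) → ℝ) (x : Fin d → ℝ) : score η x = 1 / 2 + |η x - 1 / 2| := by
  rw [score, max_def, abs_eq_max_neg, max_def]
  split_ifs <;> linarith

lemma abs_score_sub_score_le (x : Fin d → ℝ) : |score η' x - score η x| ≤ |η' x - η x| := by
  rw [score_eq, score_eq, add_sub_add_left_eq_sub]
  simpa using abs_abs_sub_abs_le_abs_sub (η' x - 1 / 2) (η x - 1 / 2)

lemma measurable_score (hη : Measurable η) : Measurable (score η) :=
  hη.max (measurable_const.sub hη)

lemma aemeasurable_score (hη : AEMeasurable η Pi) : AEMeasurable (score η) Pi :=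
  hη.max (aemeasurable_const.sub hη)

lemma aemeasurable_plugIn (hη : AEMeasurable η Pi) : AEMeasurable (plugIn η) Pi := by
  have hdecide : Measurable fun t : ℝ => (open Classical in decide (1 / 2 ≤ t)) := by
    refine measurable_to_bool ((measurableSet_Ici (a := (1 / 2 : ℝ))).congr ?_)
    ext t
    simp
  exact hdecide.comp_aemeasurable hη

end Score

section Risk

variable {P : Measure ((Fin d → ℝ) × Bool)} {η : (Fin d → ℝ) → ℝ} {R G : Set (Fin d → ℝ)}
  {g g' : (Fin d → ℝ) → Bool}

lemma risk_congr_ae (h : g =ᵐ[P.fst] g') : risk P g = risk P g' := by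
  refine measureReal_congr (Filter.eventuallyEq_set.2 ?_)
  filter_upwards [ae_of_ae_map measurable_fst.aemeasurable h] with z hz
  rw [hz]

variable [IsFiniteMeasure P]

namespace IsRegressionFunction

lemma real_prod_true_le (h : IsRegressionFunction P η) (hR : MeasurableSet R) {b : ℝ}
    (hb0 : 0 ≤ b) (hb : ∀ᵐ x ∂P.fst, x ∈ R → η x ≤ b) :
    P.real (R ×ˢ {true}) ≤ b * P.fst.real R := by
  have hle : P (R ×ˢ {true}) ≤ ENNReal.ofReal b * P.fst R := by
    rw [h.setLIntegral_eq R hR, ← setLIntegral_const]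
    exact setLIntegral_mono_ae aemeasurable_const
      (hb.mono fun x hx hxR => ENNReal.ofReal_le_ofReal (hx hxR))
  simpa [measureReal_def, ENNReal.toReal_ofReal hb0] using ENNReal.toReal_mono
    (ENNReal.mul_ne_top ENNReal.ofReal_ne_top (measure_ne_top _ _)) hle

lemma le_real_prod_true (h : IsRegressionFunction P η) (hR : MeasurableSet R) {a : ℝ}
    (ha : ∀ᵐ x ∂P.fst, x ∈ R → a ≤ η x) : a * P.fst.real R ≤ P.real (R ×ˢ {true}) := by
  rcases le_total a 0 with ha0 | ha0
  · exact (mul_nonpos_of_nonpos_of_nonneg ha0 measureReal_nonneg).trans measureReal_nonneg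
  have hle : ENNReal.ofReal a * P.fst R ≤ P (R ×ˢ {true}) := by
    rw [h.setLIntegral_eq R hR, ← setLIntegral_const]
    exact setLIntegral_mono_ae h.aemeasurable.ennreal_ofReal.restrict
      (ha.mono fun x hx hxR => ENNReal.ofReal_le_ofReal (hx hxR))
  simpa [measureReal_def, ENNReal.toReal_ofReal ha0] using
    ENNReal.toReal_mono (measure_ne_top _ _) hle

end IsRegressionFunction

/-- The change in risk when the label predicted on `A` is switched from `false` to `true`. -/
def switchCost (P : Measure ((Fin d → ℝ) × Bool)) (A : Set (Fin d → ℝ)) : ℝ :=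
  P.real (A ×ˢ {false}) - P.real (A ×ˢ {true})

lemma fst_real_eq_add (hR : MeasurableSet R) :
    P.fst.real R = P.real (R ×ˢ {true}) + P.real (R ×ˢ {false}) := by
  rw [measureReal_def, Measure.fst_apply hR, ← measureReal_def,
    ← measureReal_inter_add_sdiff (μ := P) (s := Prod.fst ⁻¹' R)
      (measurable_snd (measurableSet_singleton true))]
  congr 2
  ext ⟨x, b⟩
  simp [and_comm]

lemma IsRegressionFunction.abs_switchCost_le (h : IsRegressionFunction P η)
    (hR : MeasurableSet R) {Δ : ℝ} (hΔ : 0 ≤ Δ)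
    (hηR : ∀ᵐ x ∂P.fst, x ∈ R → |η x - 1 / 2| ≤ Δ) :
    |switchCost P R| ≤ 2 * Δ * P.fst.real R := by
  have hupper := h.real_prod_true_le hR (b := 1 / 2 + Δ) (by positivity)
    (hηR.mono fun x hx hxR => by linarith [(abs_le.1 (hx hxR)).2])
  have hlower := h.le_real_prod_true hR (a := 1 / 2 - Δ)
    (hηR.mono fun x hx hxR => by linarith [(abs_le.1 (hx hxR)).1])
  have hsplit := fst_real_eq_add (P := P) hR
  rw [switchCost, abs_le]
  constructor <;> linarith

lemma switchCost_eq_inter_add_sdiff (A : Set (Fin d → ℝ)) (hG : MeasurableSet G) :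
    switchCost P A = switchCost P (A ∩ G) + switchCost P (A \ G) := by
  have hsplit (b : Bool) :
      P.real (A ×ˢ {b}) = P.real ((A ∩ G) ×ˢ {b}) + P.real ((A \ G) ×ˢ {b}) := by
    rw [← measureReal_inter_add_sdiff (s := A ×ˢ {b}) (measurable_fst hG)]
    congr 2 <;> ext ⟨x, c⟩ <;> simp [and_right_comm]
  rw [switchCost, hsplit, hsplit, switchCost, switchCost]
  ring

lemma risk_eq_add_switchCost (hg : Measurable g) :
    risk P g = P.real (univ ×ˢ {true}) + switchCost P (g ⁻¹' {true}) := by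
  set G := g ⁻¹' {true}
  have hG : MeasurableSet G := hg (measurableSet_singleton true)
  have herror : {z : (Fin d → ℝ) × Bool | g z.1 ≠ z.2} = G ×ˢ {false} ∪ Gᶜ ×ˢ {true} := by
    ext ⟨x, b⟩
    cases b <;> simp [G]
  have hdisj : Disjoint (G ×ˢ {false}) (Gᶜ ×ˢ {true}) := disjoint_prod.2 (.inr (by simp))
  have htrue : P.real (univ ×ˢ {true}) = P.real (G ×ˢ {true}) + P.real (Gᶜ ×ˢ {true}) := by
    rw [← measureReal_union (disjoint_prod.2 (.inl disjoint_compl_right))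
      (hG.compl.prod (measurableSet_singleton _)), ← union_prod, union_compl_self]
  rw [risk, herror, measureReal_union hdisj (hG.compl.prod (measurableSet_singleton _)), htrue,
    switchCost]
  ring

lemma IsRegressionFunction.risk_sub_risk_le (h : IsRegressionFunction P η)
    (hg : AEMeasurable g P.fst) (hg' : AEMeasurable g' P.fst) {Δ : ℝ} (hΔ : 0 ≤ Δ)
    (hne : ∀ᵐ x ∂P.fst, g' x ≠ g x → |η x - 1 / 2| ≤ Δ) :
    risk P g' - risk P g ≤ 2 * Δ * P.fst.real {x | g' x ≠ g x} := by
  wlog hmeas : Measurable g ∧ Measurable g' generalizing g g'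
  · have hae := hg.ae_eq_mk
    have hae' := hg'.ae_eq_mk
    have hmk := this hg.measurable_mk.aemeasurable hg'.measurable_mk.aemeasurable
      (by filter_upwards [hne, hae, hae'] with x hx e e'; rwa [← e, ← e'])
      ⟨hg.measurable_mk, hg'.measurable_mk⟩
    rwa [← risk_congr_ae hae, ← risk_congr_ae hae', measureReal_congr] at hmk
    refine Filter.eventuallyEq_set.2 ?_
    filter_upwards [hae, hae'] with x e e'
    rw [e, e']
  obtain ⟨hg, hg'⟩ := hmeas
  set G := g ⁻¹' {true}
  set G' := g' ⁻¹' {true}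
  have hG : MeasurableSet G := hg (measurableSet_singleton true)
  have hG' : MeasurableSet G' := hg' (measurableSet_singleton true)
  have hunion : {x | g' x ≠ g x} = G' \ G ∪ G \ G' := by
    ext x
    cases e : g x <;> cases e' : g' x <;> simp [G, G', e, e']
  have hnear {A : Set (Fin d → ℝ)} (hA : A ⊆ {x | g' x ≠ g x}) :
      ∀ᵐ x ∂P.fst, x ∈ A → |η x - 1 / 2| ≤ Δ := hne.mono fun x hx hxA => hx (hA hxA)
  have hgain := h.abs_switchCost_le (hG'.diff hG) hΔ (hnear (hunion ▸ subset_union_left))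
  have hloss := h.abs_switchCost_le (hG.diff hG') hΔ (hnear (hunion ▸ subset_union_right))
  calc risk P g' - risk P g = switchCost P (G' \ G) - switchCost P (G \ G') := by
        rw [risk_eq_add_switchCost hg, risk_eq_add_switchCost hg',
          switchCost_eq_inter_add_sdiff G' hG, switchCost_eq_inter_add_sdiff G hG', inter_comm G]
        ring
    _ ≤ 2 * Δ * (P.fst.real (G' \ G) + P.fst.real (G \ G')) := by
        linarith [le_abs_self (switchCost P (G' \ G)), neg_abs_le (switchCost P (G \ G'))]
    _ = 2 * Δ * P.fst.real {x | g' x ≠ g x} := by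
        rw [hunion, measureReal_union disjoint_sdiff_sdiff (hG.diff hG')]

end Risk

end Distribution

/-! ### Empirical frequencies -/

section Chernoff

lemma exp_mul_indicator_sub {S : Type*} (T : Set S) (l q : ℝ) (x : S) :
    Real.exp (l * (T.indicator (fun _ => (1 : ℝ)) x - q)) =
      Real.exp (-(l * q)) + T.indicator (fun _ => Real.exp (-(l * q)) * (Real.exp l - 1)) x := by
  by_cases hx : x ∈ T
  · rw [indicator_of_mem hx, indicator_of_mem hx, mul_sub, mul_one, sub_eq_neg_add, Real.exp_add]
    ring
  · simp only [indicator_of_notMem hx, zero_sub, mul_neg, add_zero]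

variable {S : Type*} [MeasurableSpace S] {Q : Measure S} {T : Set S} {n : ℕ} {l : ℝ}

/-- The number of points of the sample `z` that fall in `T`, minus its mean when the points have
law `Q`. -/
noncomputable def countDeviation (Q : Measure S) (T : Set S) (z : Fin n → S) : ℝ :=
  ∑ i, T.indicator (fun _ => (1 : ℝ)) (z i) - n * Q.real T

lemma measurable_countDeviation (hT : MeasurableSet T) :
    Measurable (countDeviation (n := n) Q T) :=
  (Finset.measurable_fun_sum _ fun i _ =>
    (measurable_const.indicator hT).comp (measurable_pi_apply i)).sub_const _

lemma exp_mul_countDeviation (l : ℝ) (z : Fin n → S) :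
    Real.exp (l * countDeviation Q T z) =
      ∏ i, Real.exp (l * (T.indicator (fun _ => (1 : ℝ)) (z i) - Q.real T)) := by
  rw [← Real.exp_sum, ← Finset.mul_sum, Finset.sum_sub_distrib, countDeviation]
  simp

variable [IsProbabilityMeasure Q]

lemma integrable_exp_mul_indicator_sub (hT : MeasurableSet T) (l q : ℝ) :
    Integrable (fun x => Real.exp (l * (T.indicator (fun _ => (1 : ℝ)) x - q))) Q := by
  simp only [exp_mul_indicator_sub]
  exact (integrable_const _).add ((integrable_const _).indicator hT)

lemma mgf_indicator_sub_le (hT : MeasurableSet T) (hl : |l| ≤ 1) :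
    ProbabilityTheory.mgf (fun x => T.indicator (fun _ => (1 : ℝ)) x - Q.real T) Q l ≤
      Real.exp (Q.real T * l ^ 2) := by
  set q := Q.real T
  have hexp : Real.exp l - 1 - l ≤ l ^ 2 :=
    (le_abs_self _).trans (Real.abs_exp_sub_one_sub_id_le hl)
  calc ProbabilityTheory.mgf (fun x => T.indicator (fun _ => (1 : ℝ)) x - q) Q l
      = Real.exp (-(l * q)) * (q * (Real.exp l - 1) + 1) := by
        simp only [ProbabilityTheory.mgf, exp_mul_indicator_sub]
        rw [integral_add (integrable_const _) ((integrable_const _).indicator hT), integral_const,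
          integral_indicator_const _ hT, probReal_univ, one_smul, smul_eq_mul]
        ring
    _ ≤ Real.exp (-(l * q)) * Real.exp (q * (Real.exp l - 1)) := by
        gcongr
        exact Real.add_one_le_exp _
    _ = Real.exp (q * (Real.exp l - 1 - l)) := by
        rw [← Real.exp_add]
        ring_nf
    _ ≤ Real.exp (q * l ^ 2) := by gcongr

lemma integrable_exp_mul_countDeviation (hT : MeasurableSet T) (l : ℝ) :
    Integrable (fun z => Real.exp (l * countDeviation Q T z))
      (Measure.pi fun _ : Fin n => Q) := by
  simp only [exp_mul_countDeviation]
  exact Integrable.fintype_prod fun _ => integrable_exp_mul_indicator_sub hT l _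

lemma mgf_countDeviation_le (hT : MeasurableSet T) (hl : |l| ≤ 1) :
    ProbabilityTheory.mgf (countDeviation Q T) (Measure.pi fun _ : Fin n => Q) l ≤
      Real.exp (n * Q.real T * l ^ 2) := by
  calc ProbabilityTheory.mgf (countDeviation Q T) (Measure.pi fun _ : Fin n => Q) l
      = ProbabilityTheory.mgf (fun x => T.indicator (fun _ => (1 : ℝ)) x - Q.real T) Q l ^ n := by
        simp only [ProbabilityTheory.mgf, exp_mul_countDeviation]
        rw [integral_fintype_prod_eq_pow fun x =>
          Real.exp (l * (T.indicator (fun _ => (1 : ℝ)) x - Q.real T)), Fintype.card_fin]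
    _ ≤ Real.exp (Q.real T * l ^ 2) ^ n :=
        pow_le_pow_left₀ ProbabilityTheory.mgf_nonneg (mgf_indicator_sub_le hT hl) n
    _ = Real.exp (n * Q.real T * l ^ 2) := by rw [← Real.exp_nat_mul, mul_assoc]

lemma pi_le_abs_countDeviation_le (hT : MeasurableSet T) {v : ℝ} (hv : 1 ≤ v)
    (hTv : n * Q.real T ≤ v) (u : ℝ) :
    (Measure.pi fun _ : Fin n => Q) {z | u * √v ≤ |countDeviation Q T z|} ≤
      ENNReal.ofReal (2 * Real.exp (1 - u)) := by
  have hsqrt : 1 ≤ √v := Real.one_le_sqrt.2 hv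
  set l := (√v)⁻¹
  have hl : 0 ≤ l := by positivity
  have hl1 : |l| ≤ 1 := by
    rw [abs_of_nonneg hl]
    exact inv_le_one_of_one_le₀ hsqrt
  have hlu : l * (u * √v) = u := by
    simp only [l]
    field_simp
  have hvl : n * Q.real T * l ^ 2 ≤ 1 := by
    calc n * Q.real T * l ^ 2 ≤ v * l ^ 2 := by gcongr
      _ = 1 := by rw [inv_pow, Real.sq_sqrt (by positivity), mul_inv_cancel₀ (by positivity)]
  have htail {t : ℝ} (ht : |t| ≤ 1) (ht2 : t ^ 2 = l ^ 2) :
      Real.exp (-u) * ProbabilityTheory.mgf (countDeviation Q T)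
        (Measure.pi fun _ : Fin n => Q) t ≤ Real.exp (1 - u) := by
    rw [sub_eq_neg_add, Real.exp_add]
    gcongr
    exact (mgf_countDeviation_le hT ht).trans (Real.exp_le_exp.2 (ht2 ▸ hvl))
  have hupper := ProbabilityTheory.measure_ge_le_exp_mul_mgf (u * √v) hl
    (integrable_exp_mul_countDeviation (n := n) (Q := Q) hT l)
  have hlower := ProbabilityTheory.measure_le_le_exp_mul_mgf (-(u * √v)) (neg_nonpos.2 hl)
    (integrable_exp_mul_countDeviation (n := n) (Q := Q) hT (-l))
  rw [neg_mul, hlu] at hupper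
  rw [neg_neg, mul_neg, hlu] at hlower
  rw [ENNReal.le_ofReal_iff_toReal_le (measure_ne_top _ _) (by positivity), ← measureReal_def]
  have hcover : {z : Fin n → S | u * √v ≤ |countDeviation Q T z|} ⊆
      {z | u * √v ≤ countDeviation Q T z} ∪ {z | countDeviation Q T z ≤ -(u * √v)} :=
    fun _ hz => (le_abs.1 (mem_ofPred_eq ▸ hz)).imp_right fun h => le_neg.1 h
  calc _ ≤ _ := measureReal_mono hcover
    _ ≤ _ := measureReal_union_le _ _
    _ ≤ Real.exp (1 - u) + Real.exp (1 - u) :=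
      add_le_add (hupper.trans (htail hl1 rfl))
        (hlower.trans (htail (by rwa [abs_neg]) (neg_sq l)))
    _ = 2 * Real.exp (1 - u) := (two_mul _).symm

end Chernoff

/-! ### Active samples -/

section FactorsCountably

variable {Ω α β : Type*} {m₀ m₁ : MeasurableSpace Ω} {F : Ω → α} {G : Ω → β}

/-- `F` is a function of a countably-valued `m₀`-measurable variable, so that conditioning on `F`
amounts to summing over countably many events of `m₀`. -/
def FactorsCountably (m₀ : MeasurableSpace Ω) (F : Ω → α) : Prop :=
  ∃ f : Ω → ℕ, Measurable[m₀] f ∧ F.FactorsThrough f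

namespace FactorsCountably

lemma const (a : α) : FactorsCountably m₀ fun _ => a :=
  ⟨fun _ => 0, measurable_const, fun _ _ _ => rfl⟩

lemma of_measurable [Countable α] [MeasurableSpace α] [DiscreteMeasurableSpace α]
    (hF : Measurable[m₀] F) : FactorsCountably m₀ F := by
  obtain ⟨e, he⟩ := exists_injective_nat α
  exact ⟨e ∘ F, Measurable.of_discrete.comp hF, fun _ _ h => he h⟩

lemma mono (hF : FactorsCountably m₀ F) (h : m₀ ≤ m₁) : FactorsCountably m₁ F :=
  hF.imp fun _ hf => ⟨hf.1.mono h le_rfl, hf.2⟩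

lemma prodMk (hF : FactorsCountably m₀ F) (hG : FactorsCountably m₀ G) :
    FactorsCountably m₀ fun ω => (F ω, G ω) := by
  obtain ⟨f, hf, hfF⟩ := hF
  obtain ⟨g, hg, hgG⟩ := hG
  refine ⟨fun ω => Nat.pair (f ω) (g ω), ?_, fun ω ω' h => ?_⟩
  · exact (Measurable.of_discrete (f := fun p : ℕ × ℕ => Nat.pair p.1 p.2)).comp (hf.prodMk hg)
  · obtain ⟨hfω, hgω⟩ := Nat.pair_eq_pair.1 h
    exact Prod.ext (hfF hfω) (hgG hgω)

lemma of_factorsThrough (hF : FactorsCountably m₀ F) (h : G.FactorsThrough F) :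
    FactorsCountably m₀ G :=
  hF.imp fun _ hf => ⟨hf.1, fun _ _ hω => h (hf.2 hω)⟩

end FactorsCountably

end FactorsCountably

section ActiveSample

variable {Ω : Type*} [mΩ : MeasurableSpace Ω] {μ : Measure Ω}

lemma measure_le_of_measure_preimage_inter_le [IsProbabilityMeasure μ]
    {α : Type*} [Countable α] [MeasurableSpace α] [MeasurableSingletonClass α] {f : Ω → α}
    (hf : Measurable f) {S : Set Ω} {ε : ENNReal} (h : ∀ a, μ (f ⁻¹' {a} ∩ S) ≤ μ (f ⁻¹' {a}) * ε) :
    μ S ≤ ε :=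
  calc μ S = μ (⋃ a, f ⁻¹' {a} ∩ S) := by
        rw [← iUnion_inter, ← preimage_iUnion, iUnion_of_singleton, preimage_univ, univ_inter]
    _ ≤ ∑' a, μ (f ⁻¹' {a} ∩ S) := measure_iUnion_le _
    _ ≤ ∑' a, μ (f ⁻¹' {a}) * ε := ENNReal.tsum_le_tsum h
    _ = ε := by
        rw [ENNReal.tsum_mul_right, ← measure_iUnion (fun a b hab =>
          (disjoint_singleton.2 hab).preimage f) fun a => hf (measurableSet_singleton a),
          ← preimage_iUnion, iUnion_of_singleton, preimage_univ, measure_univ, one_mul]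

variable {d : ℕ} {P : Measure ((Fin d → ℝ) × Bool)} {A : ℕ → Ω → Set (Fin d → ℝ)}
  {Z : ℕ → ℕ → Ω → (Fin d → ℝ) × Bool} {k : ℕ}

namespace IsActiveSample

lemma pastData_le (h : IsActiveSample μ P A Z) (k : ℕ) : pastData Z k ≤ mΩ :=
  iSup_le fun j => iSup_le fun _ => iSup_le fun i => (h.measurable j i).comap_le

variable [IsProbabilityMeasure μ]

lemma measure_inter_eq (h : IsActiveSample μ P A Z) {S : Set Ω}
    (hS : MeasurableSet[pastData Z k] S) {B : Set (Fin d → ℝ)} (hB : ∀ ω ∈ S, A k ω = B)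
    [IsProbabilityMeasure (ProbabilityTheory.cond P (B ×ˢ univ))] {n : ℕ}
    {E : Set (Fin n → (Fin d → ℝ) × Bool)} (hE : MeasurableSet E) :
    μ (S ∩ {ω | (fun i : Fin n => Z k i ω) ∈ E}) =
      μ S * Measure.pi (fun _ : Fin n => ProbabilityTheory.cond P (B ×ˢ univ)) E := by
  have hS' : MeasurableSet S := h.pastData_le k S hS
  let sample (ω : Ω) (i : Fin n) := Z k i ω
  have hsample : Measurable sample := measurable_pi_lambda _ fun i => h.measurable k i
  rcases eq_or_ne (μ S) 0 with h0 | h0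
  · rw [h0, zero_mul]
    exact measure_mono_null inter_subset_left h0
  have hpi : Measure.pi (fun _ : Fin n => ProbabilityTheory.cond P (B ×ˢ univ)) =
      (μ S)⁻¹ • (μ.restrict S).map sample := by
    refine Measure.pi_eq fun T hT => ?_
    have hbox : sample ⁻¹' univ.pi T ∩ S = S ∩ {ω | ∀ i : Fin n, Z k i ω ∈ T i} := by
      ext ω
      simp [sample, and_comm]
    have hlaw : μ (S ∩ {ω | ∀ i : Fin n, Z k i ω ∈ T i}) =
        (∏ i, ProbabilityTheory.cond P (B ×ˢ univ) (T i)) * μ S := by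
      rw [h.cond_law k S hS n T hT, ← setLIntegral_const]
      exact setLIntegral_congr_fun hS' fun ω hω => by simp only [hB ω hω]
    rw [Measure.smul_apply, Measure.map_apply hsample (.univ_pi hT),
      Measure.restrict_apply (hsample (.univ_pi hT)), smul_eq_mul, hbox, hlaw, mul_left_comm,
      ENNReal.inv_mul_cancel h0 (measure_ne_top _ _), mul_one]
  rw [hpi, Measure.smul_apply, Measure.map_apply hsample hE, Measure.restrict_apply (hsample hE),
    smul_eq_mul, ENNReal.mul_inv_cancel_left h0 (measure_ne_top _ _), inter_comm]
  rfl

lemma measure_le_abs_countDeviation_le [IsFiniteMeasure P] (h : IsActiveSample μ P A Z)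
    (hA : FactorsCountably (pastData Z k) (A k)) (hP : ∀ ω, P (A k ω ×ˢ univ) ≠ 0)
    {T : Set ((Fin d → ℝ) × Bool)} (hT : MeasurableSet T) (n : Set (Fin d → ℝ) → ℕ)
    (v : Set (Fin d → ℝ) → ℝ) (hv : ∀ ω, 1 ≤ v (A k ω))
    (hTv : ∀ ω, n (A k ω) * (ProbabilityTheory.cond P (A k ω ×ˢ univ)).real T ≤ v (A k ω))
    (u : ℝ) :
    μ {ω | u * √(v (A k ω)) ≤ |countDeviation (ProbabilityTheory.cond P (A k ω ×ˢ univ)) T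
      fun i : Fin (n (A k ω)) => Z k i ω|} ≤ ENNReal.ofReal (2 * Real.exp (1 - u)) := by
  obtain ⟨f, hf, hfA⟩ := hA
  refine measure_le_of_measure_preimage_inter_le (hf.mono (h.pastData_le k) le_rfl) fun a => ?_
  rcases (f ⁻¹' {a}).eq_empty_or_nonempty with he | ⟨ω₀, hω₀⟩
  · simp [he]
  have hconst : ∀ ω ∈ f ⁻¹' {a}, A k ω = A k ω₀ := fun ω hω => hfA (hω.trans hω₀.symm)
  have := ProbabilityTheory.cond_isProbabilityMeasure (hP ω₀)
  calc _ ≤ μ (f ⁻¹' {a} ∩ {ω | (fun i : Fin (n (A k ω₀)) => Z k i ω) ∈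
        {z | u * √(v (A k ω₀)) ≤
          |countDeviation (ProbabilityTheory.cond P (A k ω₀ ×ˢ univ)) T z|}}) := by
        refine measure_mono fun ω hω => ⟨hω.1, ?_⟩
        have hωdev := hω.2
        rwa [mem_ofPred_eq, hconst ω hω.1] at hωdev
    _ = _ := h.measure_inter_eq (hf (measurableSet_singleton a)) hconst
        (measurableSet_le measurable_const (measurable_countDeviation hT).abs)
    _ ≤ _ := by
        gcongr
        exact pi_le_abs_countDeviation_le hT (hv ω₀) (hTv ω₀) u

end IsActiveSample

end ActiveSample

/-! ### Step sizes, bandwidths and rejection rates -/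

section Parameters

variable {d N : ℕ} {cN δ : ℝ}

lemma one_le_stepSize (hcN : 1 ≤ cN) (hN : 1 ≤ N) (k : ℕ) : 1 ≤ stepSize cN N k := by
  induction k with
  | zero => exact Nat.sqrt_pos.2 hN
  | succ k ih =>
    refine Nat.le_floor ?_
    rw [Nat.cast_one]
    exact one_le_mul_of_one_le_of_one_le hcN (Nat.one_le_cast.2 ih)

lemma stepSize_mono (hcN : 1 ≤ cN) : Monotone (stepSize cN N) :=
  monotone_nat_of_le_succ fun _ => Nat.le_floor (le_mul_of_one_le_left (Nat.cast_nonneg _) hcN)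

lemma stepSize_succ_le (hcN : 1 ≤ cN) (k : ℕ) :
    (stepSize cN N (k + 1) : ℝ) ≤ cN * stepSize cN N k :=
  Nat.floor_le (mul_nonneg (zero_le_one.trans hcN) (Nat.cast_nonneg _))

lemma bandwidth_pos (hcN : 1 ≤ cN) (hN : 1 ≤ N) (k : ℕ) : 0 < bandwidth d cN N k :=
  Real.rpow_pos_of_pos (Nat.cast_pos.2 (one_le_stepSize hcN hN k)) _

lemma bandwidth_le_one (hcN : 1 ≤ cN) (hN : 1 ≤ N) (k : ℕ) : bandwidth d cN N k ≤ 1 :=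
  Real.rpow_le_one_of_one_le_of_nonpos (Nat.one_le_cast.2 (one_le_stepSize hcN hN k))
    (neg_nonpos.2 (by positivity))

lemma bandwidth_anti (hcN : 1 ≤ cN) (hN : 1 ≤ N) : Antitone (bandwidth d cN N) := fun j _ hjk =>
  Real.rpow_le_rpow_of_nonpos (Nat.cast_pos.2 (one_le_stepSize hcN hN j))
    (Nat.cast_le.2 (stepSize_mono hcN hjk)) (neg_nonpos.2 (by positivity))

lemma stepSize_mul_bandwidth_pow (hcN : 1 ≤ cN) (hN : 1 ≤ N) (k : ℕ) :
    (stepSize cN N k : ℝ) * bandwidth d cN N k ^ (d + 2) = 1 := by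
  have hpos : (0 : ℝ) < stepSize cN N k := Nat.cast_pos.2 (one_le_stepSize hcN hN k)
  have hexp : -(1 / ((d : ℝ) + 2)) * ((d + 2 : ℕ) : ℝ) = -1 := by
    push_cast
    field_simp
  rw [bandwidth, ← Real.rpow_mul_natCast hpos.le, hexp, Real.rpow_neg_one,
    mul_inv_cancel₀ hpos.ne']

lemma stepSize_mul_bandwidth_pow_eq (hcN : 1 ≤ cN) (hN : 1 ≤ N) (k : ℕ) :
    ((stepSize cN N k : ℝ) * bandwidth d cN N k) ^ (d + 2) = (stepSize cN N k : ℝ) ^ (d + 1) := by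
  rw [mul_pow, pow_succ _ (d + 1), mul_assoc, stepSize_mul_bandwidth_pow hcN hN, mul_one]

lemma stepSize_mul_bandwidth_mono (hcN : 1 ≤ cN) (hN : 1 ≤ N) :
    Monotone fun k => (stepSize cN N k : ℝ) * bandwidth d cN N k := fun j k hjk => by
  refine le_of_pow_le_pow_left₀ (n := d + 2) (by omega)
    (mul_nonneg (Nat.cast_nonneg _) (bandwidth_pos hcN hN k).le) ?_
  rw [stepSize_mul_bandwidth_pow_eq hcN hN, stepSize_mul_bandwidth_pow_eq hcN hN]
  gcongr
  exact stepSize_mono hcN hjk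

lemma one_le_stepSize_mul_bandwidth (hcN : 1 ≤ cN) (hN : 1 ≤ N) (k : ℕ) :
    1 ≤ (stepSize cN N k : ℝ) * bandwidth d cN N k := by
  refine le_of_pow_le_pow_left₀ (n := d + 2) (by omega)
    (mul_nonneg (Nat.cast_nonneg _) (bandwidth_pos hcN hN k).le) ?_
  rw [stepSize_mul_bandwidth_pow_eq hcN hN, one_pow]
  exact one_le_pow₀ (Nat.one_le_cast.2 (one_le_stepSize hcN hN k))

lemma log_le_log_div (hδ : δ ∈ Ioc 0 1) : Real.log N ≤ Real.log ((N : ℝ) / δ) := by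
  rcases N.eq_zero_or_pos with rfl | hN
  · simp
  · exact Real.log_le_log (Nat.cast_pos.2 hN) (le_div_self N.cast_nonneg hδ.1 hδ.2)

lemma log_div_nonneg (hδ : δ ∈ Ioc 0 1) : 0 ≤ Real.log ((N : ℝ) / δ) :=
  (Real.log_natCast_nonneg N).trans (log_le_log_div hδ)

lemma one_le_log_natCast (hN : 3 ≤ N) : 1 ≤ Real.log N := by
  rw [Real.le_log_iff_exp_le (Nat.cast_pos.2 (by omega))]
  exact Real.exp_one_lt_three.le.trans (Nat.ofNat_le_cast.2 hN)

lemma rejectionRate_succ (k : ℕ) : rejectionRate d cN N δ (k + 1) =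
    min 1 (Real.log ((N : ℝ) / δ) * Real.log N * bandwidth d cN N k) := by
  simp only [rejectionRate, bandwidth, add_comm (2 : ℝ)]

lemma rejectionRate_nonneg (hcN : 1 ≤ cN) (hN : 1 ≤ N) (hδ : δ ∈ Ioc 0 1) (k : ℕ) :
    0 ≤ rejectionRate d cN N δ k := by
  cases k with
  | zero => exact zero_le_one
  | succ k =>
    rw [rejectionRate_succ]
    exact le_min zero_le_one (mul_nonneg (mul_nonneg (log_div_nonneg hδ)
      (Real.log_natCast_nonneg N)) (bandwidth_pos hcN hN k).le)

lemma rejectionRate_anti (hcN : 1 ≤ cN) (hN : 1 ≤ N) (hδ : δ ∈ Ioc 0 1) :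
    Antitone (rejectionRate d cN N δ) := by
  refine antitone_nat_of_succ_le fun k => ?_
  cases k with
  | zero => exact min_le_left _ _
  | succ k =>
    rw [rejectionRate_succ, rejectionRate_succ]
    exact min_le_min le_rfl (mul_le_mul_of_nonneg_left (bandwidth_anti hcN hN k.le_succ)
      (mul_nonneg (log_div_nonneg hδ) (Real.log_natCast_nonneg N)))

lemma bandwidth_le_rejectionRate (hcN : 1 ≤ cN) (hN : 3 ≤ N) (hδ : δ ∈ Ioc 0 1) (k : ℕ) :
    bandwidth d cN N k ≤ rejectionRate d cN N δ k := by
  have hN1 : 1 ≤ N := by omega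
  cases k with
  | zero => exact bandwidth_le_one hcN hN1 0
  | succ k =>
    rw [rejectionRate_succ]
    refine (bandwidth_anti hcN hN1 k.le_succ).trans (le_min (bandwidth_le_one hcN hN1 k) ?_)
    have hlog := one_le_log_natCast hN
    exact le_mul_of_one_le_left (bandwidth_pos hcN hN1 k).le
      (one_le_mul_of_one_le_of_one_le (hlog.trans (log_le_log_div hδ)) hlog)

/-- The budget is large enough for the rounded step sizes `⌊cN * N_k⌋` to keep growing
geometrically. The bound `8 ≤ N` absorbs numerical constants into powers of `N`. -/
structure IsLargeBudget (cN : ℝ) (N : ℕ) : Prop where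
  eight_le : 8 ≤ N
  one_le_mul_stepSize : 1 ≤ (cN - 1) / 2 * stepSize cN N 0

namespace IsLargeBudget

lemma one_le (hB : IsLargeBudget cN N) : 1 ≤ N := le_trans (by norm_num) hB.eight_le

lemma three_le (hB : IsLargeBudget cN N) : 3 ≤ N := le_trans (by norm_num) hB.eight_le

lemma one_lt_growth (hB : IsLargeBudget cN N) : 1 < cN := by
  have hpos := pos_of_mul_pos_left (zero_lt_one.trans_le hB.one_le_mul_stepSize)
    (Nat.cast_nonneg _)
  linarith

lemma mul_stepSize_le_succ (hB : IsLargeBudget cN N) (k : ℕ) :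
    (1 + cN) / 2 * stepSize cN N k ≤ stepSize cN N (k + 1) := by
  have hcN := hB.one_lt_growth
  have hfloor : cN * (stepSize cN N k : ℝ) < stepSize cN N (k + 1) + 1 := Nat.lt_floor_add_one _
  have hmargin : 1 ≤ (cN - 1) / 2 * (stepSize cN N k : ℝ) :=
    hB.one_le_mul_stepSize.trans (mul_le_mul_of_nonneg_left
      (Nat.cast_le.2 (stepSize_mono hcN.le (Nat.zero_le k))) (by linarith))
  linarith

lemma strictMono_stepSize (hB : IsLargeBudget cN N) : StrictMono (stepSize cN N) := by
  refine strictMono_nat_of_lt_succ fun k => (Nat.cast_lt (α := ℝ)).1 ?_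
  have hcN := hB.one_lt_growth
  exact (lt_mul_of_one_lt_left (Nat.cast_pos.2 (one_le_stepSize hcN.le hB.one_le k))
    (by linarith)).trans_le (hB.mul_stepSize_le_succ k)

lemma pow_le_stepSize (hB : IsLargeBudget cN N) (k : ℕ) :
    ((1 + cN) / 2) ^ k ≤ stepSize cN N k := by
  have hcN := hB.one_lt_growth
  induction k with
  | zero => simpa using one_le_stepSize hcN.le hB.one_le 0
  | succ k ih =>
    refine le_trans ?_ (hB.mul_stepSize_le_succ k)
    rw [pow_succ']
    exact mul_le_mul_of_nonneg_left ih (by linarith)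

end IsLargeBudget

end Parameters

/-! ### Uncertain regions -/

section Region

/-- Side subdivisions of a sequence of cubic partitions, each refining the previous one. -/
structure IsRefining (m : ℕ → ℕ) : Prop where
  pos : ∀ k, 0 < m k
  dvd_succ : ∀ k, m k ∣ m (k + 1)

variable {d N : ℕ} {cN δ : ℝ} {P : Measure ((Fin d → ℝ) × Bool)} {m : ℕ → ℕ}
  {D : ℕ → ℕ → (Fin d → ℝ) × Bool}

lemma region_succ (k : ℕ) : region P N δ cN m D (k + 1) =
    {x | x ∈ region P N δ cN m D k ∧ (score (stepEstimator P N δ cN m D k) x : EReal) ≤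
      threshold P.fst (region P N δ cN m D k) (score (stepEstimator P N δ cN m D k))
        (rejectionRate d cN N δ (k + 1))} := rfl

lemma region_anti : Antitone (region P N δ cN m D) :=
  antitone_nat_of_succ_le fun _ _ hx => hx.1

lemma measurable_stepEstimator (k : ℕ) : Measurable (stepEstimator P N δ cN m D k) :=
  measurable_histogram _ _ _ _ _

lemma isCellUnion_region (hm : IsRefining m) (k : ℕ) :
    IsCellUnion (m k) (region P N δ cN m D k) := by
  induction k with
  | zero => exact IsCellUnion.unitCube _
  | succ k ih =>
    refine IsCellUnion.of_dvd (m := m k) ⟨fun x hx => ih.subset hx.1, fun x hx z hz => ?_⟩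
      (hm.dvd_succ k) (hm.pos _)
    refine ⟨ih.gridCell_subset x hx.1 hz, ?_⟩
    simpa only [score, histogram_eq_of_mem hz] using hx.2

lemma labelCount_le [IsProbabilityMeasure P] (n : ℕ) (A : Set (Fin d → ℝ)) :
    labelCount P.fst n A ≤ n :=
  Nat.floor_le_of_le (mul_le_of_le_one_right n.cast_nonneg measureReal_le_one)

lemma half_le_natFloor {a : ℝ} (ha : 1 ≤ a) : a / 2 ≤ ⌊a⌋₊ := by
  have hlt := Nat.lt_floor_add_one a
  have hone : (1 : ℝ) ≤ ⌊a⌋₊ := Nat.one_le_cast.2 (Nat.le_floor (by simpa using ha))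
  linarith

variable [IsProbabilityMeasure P]

lemma rejectionRate_le_real_region (hcN : 1 ≤ cN) (hN : 1 ≤ N) (hδ : δ ∈ Ioc 0 1)
    (hm : IsRefining m) (hcube : P.fst.real (unitCube d) = 1) (k : ℕ) :
    rejectionRate d cN N δ k ≤ P.fst.real (region P N δ cN m D k) := by
  induction k with
  | zero => exact hcube.ge
  | succ k ih =>
    rw [region_succ]
    exact (le_min ((rejectionRate_anti hcN hN hδ k.le_succ).trans ih) le_rfl).trans
      (min_le_real_le_threshold (isCellUnion_region hm k).measurableSet
        (measurable_score (measurable_stepEstimator k)))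

lemma bandwidth_le_real_region (hcN : 1 ≤ cN) (hN : 3 ≤ N) (hδ : δ ∈ Ioc 0 1)
    (hm : IsRefining m) (hcube : P.fst.real (unitCube d) = 1) (k : ℕ) :
    bandwidth d cN N k ≤ P.fst.real (region P N δ cN m D k) :=
  (bandwidth_le_rejectionRate hcN hN hδ k).trans
    (rejectionRate_le_real_region hcN (by omega) hδ hm hcube k)

lemma half_le_labelCount_region (hcN : 1 ≤ cN) (hN : 3 ≤ N) (hδ : δ ∈ Ioc 0 1)
    (hm : IsRefining m) (hcube : P.fst.real (unitCube d) = 1) (k : ℕ) :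
    stepSize cN N k * P.fst.real (region P N δ cN m D k) / 2 ≤
      labelCount P.fst (stepSize cN N k) (region P N δ cN m D k) :=
  half_le_natFloor ((one_le_stepSize_mul_bandwidth hcN (by omega) k).trans
    (mul_le_mul_of_nonneg_left (bandwidth_le_real_region hcN hN hδ hm hcube k)
      (Nat.cast_nonneg _)))

end Region

/-! ### Accuracy of one step -/

section PointCode

variable {d m : ℕ}

/-- The information about a labelled point that the histogram rule uses: whether it lies in the
cube, its cell, and its label. -/
noncomputable def pointCode (m : ℕ) (z : (Fin d → ℝ) × Bool) : Bool × (Fin d → ℕ) × Bool :=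
  open Classical in (decide (z.1 ∈ unitCube d), gridIndex m z.1, z.2)

lemma measurable_pointCode (m : ℕ) : Measurable (pointCode (d := d) m) := by
  classical
  refine Measurable.prodMk (measurable_to_bool ?_)
    (((measurable_gridIndex m).comp measurable_fst).prodMk measurable_snd)
  refine (measurable_fst (measurableSet_unitCube (d := d))).congr ?_
  ext z
  simp

lemma mem_gridCell_iff_of_pointCode_eq {z z' : (Fin d → ℝ) × Bool}
    (h : pointCode m z = pointCode m z') (x : Fin d → ℝ) :
    z.1 ∈ gridCell m x ↔ z'.1 ∈ gridCell m x := by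
  have hcube : z.1 ∈ unitCube d ↔ z'.1 ∈ unitCube d := decide_eq_decide.1 (congrArg Prod.fst h)
  have hindex : gridIndex m z.1 = gridIndex m z'.1 := congrArg (fun c => c.2.1) h
  rw [gridCell_eq_cellOf, cellOf, mem_inter_iff, mem_inter_iff, hcube, mem_preimage, hindex,
    mem_preimage]

lemma histogram_congr {Pi : Measure (Fin d → ℝ)} {A : Set (Fin d → ℝ)} {n : ℕ}
    {D D' : ℕ → (Fin d → ℝ) × Bool} (h : ∀ j < n, pointCode m (D j) = pointCode m (D' j)) :
    histogram Pi A n m D = histogram Pi A n m D' := by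
  ext x
  unfold histogram
  congr 2
  refine Finset.sum_congr rfl fun j hj => ?_
  have hcode := h j (Finset.mem_range.1 hj)
  rw [show (D j).2 = (D' j).2 from congrArg (fun c => c.2.2) hcode]
  congr 1
  by_cases hx : (D j).1 ∈ gridCell m x
  · rw [indicator_of_mem hx,
      indicator_of_mem ((mem_gridCell_iff_of_pointCode_eq hcode x).1 hx)]
  · rw [indicator_of_notMem hx,
      indicator_of_notMem (mt (mem_gridCell_iff_of_pointCode_eq hcode x).2 hx)]

end PointCode

section FactorsCountably

variable {d N : ℕ} {cN δ : ℝ} {P : Measure ((Fin d → ℝ) × Bool)} {m : ℕ → ℕ} {Ω S : Type*}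

lemma pastData_mono [MeasurableSpace S] (Z : ℕ → ℕ → Ω → S) : Monotone (pastData Z) :=
  fun _ _ hjk => iSup_mono fun _ => iSup_mono' fun h => ⟨h.trans_le hjk, le_rfl⟩

lemma measurable_pastData [MeasurableSpace S] (Z : ℕ → ℕ → Ω → S) {j k : ℕ} (h : j < k) (i : ℕ) :
    Measurable[pastData Z k] (Z j i) :=
  (comap_measurable (Z j i)).mono
    (le_iSup_of_le j (le_iSup_of_le h (le_iSup_of_le i le_rfl))) le_rfl

lemma region_succ_congr [IsProbabilityMeasure P] {D D' : ℕ → ℕ → (Fin d → ℝ) × Bool} {k : ℕ}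
    (hA : region P N δ cN m D k = region P N δ cN m D' k)
    (hD : ∀ j < stepSize cN N k, pointCode (m k) (D k j) = pointCode (m k) (D' k j)) :
    region P N δ cN m D (k + 1) = region P N δ cN m D' (k + 1) := by
  have hest : stepEstimator P N δ cN m D k = stepEstimator P N δ cN m D' k := by
    rw [stepEstimator, stepEstimator, hA]
    exact histogram_congr fun j hj => hD j (hj.trans_le (labelCount_le _ _))
  rw [region_succ, region_succ, hest, hA]

lemma factorsCountably_region [IsProbabilityMeasure P] (Z : ℕ → ℕ → Ω → (Fin d → ℝ) × Bool)
    (k : ℕ) :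
    FactorsCountably (pastData Z k) fun ω => region P N δ cN m (fun j i => Z j i ω) k := by
  induction k with
  | zero => exact .const _
  | succ k ih =>
    have hcodes : FactorsCountably (pastData Z (k + 1))
        fun ω (i : Fin (stepSize cN N k)) => pointCode (m k) (Z k i ω) :=
      .of_measurable (@measurable_pi_lambda _ _ _ (pastData Z (k + 1)) _ _ fun i =>
        (measurable_pointCode (m k)).comp (measurable_pastData Z k.lt_succ_self i))
    refine ((ih.mono (pastData_mono Z k.le_succ)).prodMk hcodes).of_factorsThrough
      fun ω ω' h => ?_
    exact region_succ_congr (congrArg Prod.fst h)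
      fun j hj => congrFun (congrArg Prod.snd h) ⟨j, hj⟩

end FactorsCountably

section CellAverage

variable {d n m : ℕ} {P : Measure ((Fin d → ℝ) × Bool)} {B R : Set (Fin d → ℝ)} {x : Fin d → ℝ}
  {D : ℕ → (Fin d → ℝ) × Bool}

lemma histogram_eq_sum_div (Pi : Measure (Fin d → ℝ)) (B : Set (Fin d → ℝ)) (n m : ℕ)
    (D : ℕ → (Fin d → ℝ) × Bool) (x : Fin d → ℝ) :
    histogram Pi B n m D x =
      (∑ i : Fin n, (gridCell m x ×ˢ {true}).indicator (fun _ => (1 : ℝ)) (D i)) /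
        (n * (Pi.real (gridCell m x) / Pi.real B)) := by
  have hlabel (z : (Fin d → ℝ) × Bool) :
      (if z.2 then (1 : ℝ) else 0) * (gridCell m x).indicator (fun _ => (1 : ℝ)) z.1 =
        (gridCell m x ×ˢ {true}).indicator (fun _ => (1 : ℝ)) z := by
    by_cases hx : z.1 ∈ gridCell m x <;> by_cases hz : z.2 = true <;>
      simp [indicator, hx, hz, mem_prod]
  rw [histogram, Fin.sum_univ_eq_sum_range fun j =>
    (gridCell m x ×ˢ {true}).indicator (fun _ => (1 : ℝ)) (D j)]
  simp only [hlabel, div_eq_mul_inv, mul_inv, inv_inv]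
  ring

lemma cond_real_prod_eq [IsFiniteMeasure P] (hB : MeasurableSet B) (hR : R ⊆ B) :
    (ProbabilityTheory.cond P (B ×ˢ univ)).real (R ×ˢ {true}) =
      P.real (R ×ˢ {true}) / P.fst.real B := by
  rw [measureReal_def, ProbabilityTheory.cond_apply (hB.prod MeasurableSet.univ),
    ENNReal.toReal_mul, ENNReal.toReal_inv, measureReal_def, measureReal_def,
    Measure.fst_apply hB, div_eq_inv_mul, ← prod_univ, prod_inter_prod, inter_eq_right.2 hR,
    univ_inter]

lemma cond_real_prod_le [IsFiniteMeasure P] (hB : MeasurableSet B) (hR : MeasurableSet R) :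
    (ProbabilityTheory.cond P (B ×ˢ univ)).real (R ×ˢ {true}) ≤ P.fst.real R / P.fst.real B := by
  rw [measureReal_def, ProbabilityTheory.cond_apply (hB.prod MeasurableSet.univ),
    ENNReal.toReal_mul, ENNReal.toReal_inv, measureReal_def, measureReal_def,
    Measure.fst_apply hB, Measure.fst_apply hR, div_eq_inv_mul, ← prod_univ]
  gcongr
  · exact measure_ne_top _ _
  · exact fun z hz => hz.2.1

variable {η : (Fin d → ℝ) → ℝ} {s u : ℝ} [IsFiniteMeasure P]

lemma IsRegressionFunction.abs_condMean_sub_le (h : IsRegressionFunction P η) (hs0 : 0 ≤ s)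
    (hs : IsSmooth s η) (hm : 0 < m) (hx : x ∈ unitCube d)
    (hR : 0 < P.fst.real (gridCell m x)) :
    |P.real (gridCell m x ×ˢ {true}) / P.fst.real (gridCell m x) - η x| ≤ s * (1 / m) := by
  have hosc : ∀ z ∈ gridCell m x, |η z - η x| ≤ s * (1 / m) := fun z hz =>
    (hs z hz.1 x hx).trans (mul_le_mul_of_nonneg_left (norm_sub_le_of_mem_gridCell hm hx hz) hs0)
  have hupper := h.real_prod_true_le (measurableSet_gridCell m x) (b := η x + s * (1 / m))
    (add_nonneg (h.mem_Icc x hx).1 (by positivity))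
    (.of_forall fun z hz => by linarith [(abs_le.1 (hosc z hz)).2])
  have hlower := h.le_real_prod_true (measurableSet_gridCell m x) (a := η x - s * (1 / m))
    (.of_forall fun z hz => by linarith [(abs_le.1 (hosc z hz)).1])
  rw [abs_le]
  constructor
  · linarith [(le_div_iff₀ hR).2 hlower]
  · linarith [(div_le_iff₀ hR).2 hupper]

lemma histogram_sub_condMean_eq (hB : IsCellUnion m B) (hx : x ∈ B)
    (hv : n * (P.fst.real (gridCell m x) / P.fst.real B) ≠ 0) :
    histogram P.fst B n m D x - P.real (gridCell m x ×ˢ {true}) / P.fst.real (gridCell m x) =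
      countDeviation (ProbabilityTheory.cond P (B ×ˢ univ)) (gridCell m x ×ˢ {true})
        (fun i : Fin n => D i) / (n * (P.fst.real (gridCell m x) / P.fst.real B)) := by
  obtain ⟨hn, hR, hBne⟩ : (n : ℝ) ≠ 0 ∧ P.fst.real (gridCell m x) ≠ 0 ∧ P.fst.real B ≠ 0 := by
    simpa only [mul_ne_zero_iff, div_ne_zero_iff] using hv
  rw [histogram_eq_sum_div, countDeviation,
    cond_real_prod_eq hB.measurableSet (hB.gridCell_subset x hx)]
  field_simp

lemma IsRegressionFunction.abs_histogram_sub_le (h : IsRegressionFunction P η) (hs0 : 0 ≤ s)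
    (hs : IsSmooth s η) (hm : 0 < m) (hB : IsCellUnion m B) (hx : x ∈ B)
    (hv : 0 < n * (P.fst.real (gridCell m x) / P.fst.real B))
    (hdev : |countDeviation (ProbabilityTheory.cond P (B ×ˢ univ)) (gridCell m x ×ˢ {true})
      fun i : Fin n => D i| ≤ u * √(n * (P.fst.real (gridCell m x) / P.fst.real B))) :
    |histogram P.fst B n m D x - η x| ≤
      u / √(n * (P.fst.real (gridCell m x) / P.fst.real B)) + s * (1 / m) := by
  have hR : 0 < P.fst.real (gridCell m x) := by
    refine measureReal_nonneg.lt_of_ne fun h0 => hv.ne ?_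
    rw [← h0, zero_div, mul_zero]
  refine (abs_sub_le _ (P.real (gridCell m x ×ˢ {true}) / P.fst.real (gridCell m x)) _).trans
    (add_le_add ?_ (h.abs_condMean_sub_le hs0 hs hm (hB.subset hx) hR))
  rw [histogram_sub_condMean_eq hB hx hv.ne', abs_div, abs_of_pos hv, div_le_iff₀ hv]
  refine hdev.trans_eq ?_
  rw [div_mul_eq_mul_div, mul_div_assoc, Real.div_sqrt]

end CellAverage

section StepAccuracy

variable {d N : ℕ} {cN δ : ℝ} {P : Measure ((Fin d → ℝ) × Bool)} {m : ℕ → ℕ}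

/-- Step `k` estimates `η` up to `Δ` everywhere on the region that is still uncertain. -/
def IsAccurateStep (P : Measure ((Fin d → ℝ) × Bool)) (N : ℕ) (δ cN : ℝ) (m : ℕ → ℕ)
    (D : ℕ → ℕ → (Fin d → ℝ) × Bool) (η : (Fin d → ℝ) → ℝ) (k : ℕ) (Δ : ℝ) : Prop :=
  ∀ x ∈ region P N δ cN m D k, |stepEstimator P N δ cN m D k x - η x| ≤ Δ

/-- A cell at step `k` receives at least `cellMassConst d μmin κ / r_k ^ 2` points on average. -/
noncomputable def cellMassConst (d : ℕ) (μmin κ : ℝ) : ℝ := μmin / (2 * κ ^ d)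

lemma cellMassConst_pos {μmin κ : ℝ} (hμmin : 0 < μmin) (hκ : 0 < κ) :
    0 < cellMassConst d μmin κ := by
  unfold cellMassConst
  positivity

lemma pow_le_mul_stepSize {κ : ℝ} {q : ℕ} (hcN : 1 ≤ cN) (hN : 1 ≤ N) (hκ : 0 < κ) (hq : 0 < q)
    {k : ℕ} (hwidth : bandwidth d cN N k / κ ≤ 1 / (q : ℝ)) :
    (q : ℝ) ^ d ≤ κ ^ d * stepSize cN N k := by
  set r := bandwidth d cN N k
  have hr0 : 0 < r := bandwidth_pos hcN hN k
  have hqr : q * r ≤ κ := by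
    rwa [div_le_div_iff₀ hκ (Nat.cast_pos.2 hq), one_mul, mul_comm] at hwidth
  calc (q : ℝ) ^ d = (q : ℝ) ^ d * (stepSize cN N k * r ^ (d + 2)) := by
        rw [stepSize_mul_bandwidth_pow hcN hN, mul_one]
    _ = (q * r) ^ d * stepSize cN N k * r ^ 2 := by ring
    _ ≤ κ ^ d * stepSize cN N k * 1 := by
        gcongr
        exact pow_le_one₀ hr0.le (bandwidth_le_one hcN hN k)
    _ = κ ^ d * stepSize cN N k := mul_one _

variable [IsProbabilityMeasure P] {μmin κ : ℝ}

lemma HasDensityLowerBound.cellMassConst_div_le (hPi : HasDensityLowerBound μmin P.fst)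
    (hμmin : 0 ≤ μmin) (hκ : 0 < κ) (hcN : 1 ≤ cN) (hN : 3 ≤ N) (hδ : δ ∈ Ioc 0 1)
    (hm : IsRefining m) {k : ℕ} (hwidth : bandwidth d cN N k / κ ≤ 1 / (m k : ℝ))
    (D : ℕ → ℕ → (Fin d → ℝ) × Bool) (x : Fin d → ℝ) :
    cellMassConst d μmin κ / bandwidth d cN N k ^ 2 ≤
      labelCount P.fst (stepSize cN N k) (region P N δ cN m D k) *
        (P.fst.real (gridCell (m k) x) / P.fst.real (region P N δ cN m D k)) := by
  have hN1 : 1 ≤ N := by omega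
  set r := bandwidth d cN N k
  set n := labelCount P.fst (stepSize cN N k) (region P N δ cN m D k)
  have hr0 : 0 < r := bandwidth_pos hcN hN1 k
  have hNr : (stepSize cN N k : ℝ) * r ^ (d + 2) = 1 := stepSize_mul_bandwidth_pow hcN hN1 k
  have hB : 0 < P.fst.real (region P N δ cN m D k) :=
    hr0.trans_le (bandwidth_le_real_region hcN hN hδ hm hPi.real_unitCube k)
  calc cellMassConst d μmin κ / r ^ 2 = stepSize cN N k * (μmin * (r / κ) ^ d) / 2 := by
        rw [cellMassConst, div_pow, div_eq_iff (by positivity)]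
        field_simp
        rw [pow_add] at hNr
        linear_combination -μmin * hNr
    _ ≤ stepSize cN N k * (μmin * (1 / (m k : ℝ)) ^ d) / 2 := by gcongr
    _ ≤ stepSize cN N k * P.fst.real (gridCell (m k) x) / 2 := by
        gcongr
        exact hPi.le_real_gridCell hμmin (hm.pos k) x
    _ = stepSize cN N k * P.fst.real (region P N δ cN m D k) / 2 *
        (P.fst.real (gridCell (m k) x) / P.fst.real (region P N δ cN m D k)) := by
        field_simp
    _ ≤ _ := by
        gcongr
        exact half_le_labelCount_region hcN hN hδ hm hPi.real_unitCube k

lemma prod_univ_ne_zero_of_fst_real_pos {B : Set (Fin d → ℝ)} (hB : MeasurableSet B)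
    (hpos : 0 < P.fst.real B) : P (B ×ˢ univ) ≠ 0 := by
  rw [prod_univ, ← Measure.fst_apply hB]
  exact (measureReal_ne_zero_iff).1 hpos.ne'

variable {η : (Fin d → ℝ) → ℝ} {s : ℝ} {k : ℕ}

lemma isAccurateStep_of_abs_countDeviation_le (h : IsRegressionFunction P η) (hs0 : 0 ≤ s)
    (hs : IsSmooth s η) (hPi : HasDensityLowerBound μmin P.fst) (hμmin : 0 < μmin) (hκ : 0 < κ)
    (hcN : 1 ≤ cN) (hN : 3 ≤ N) (hδ : δ ∈ Ioc 0 1) (hm : IsRefining m)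
    (hwidth : 1 / (m k : ℝ) ∈ Icc (bandwidth d cN N k / κ) (κ * bandwidth d cN N k))
    {u : ℝ} (hu : 0 ≤ u) {D : ℕ → ℕ → (Fin d → ℝ) × Bool}
    (hdev : ∀ x, |countDeviation (ProbabilityTheory.cond P (region P N δ cN m D k ×ˢ univ))
        (gridCell (m k) x ×ˢ {true})
        fun i : Fin (labelCount P.fst (stepSize cN N k) (region P N δ cN m D k)) => D k i| ≤
      u * √(labelCount P.fst (stepSize cN N k) (region P N δ cN m D k) *
        (P.fst.real (gridCell (m k) x) / P.fst.real (region P N δ cN m D k)))) :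
    IsAccurateStep P N δ cN m D η k
      ((u / √(cellMassConst d μmin κ) + s * κ) * bandwidth d cN N k) := by
  intro x hx
  have hr0 : 0 < bandwidth d cN N k := bandwidth_pos hcN (by omega) k
  have hc0 : 0 < cellMassConst d μmin κ := cellMassConst_pos hμmin hκ
  have hmass := hPi.cellMassConst_div_le hμmin.le hκ hcN hN hδ hm hwidth.1 D x
  refine (h.abs_histogram_sub_le hs0 hs (hm.pos k) (isCellUnion_region hm k) hx
    (lt_of_lt_of_le (by positivity) hmass) (hdev x)).trans ?_
  calc _ ≤ u / √(cellMassConst d μmin κ / bandwidth d cN N k ^ 2) +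
        s * (κ * bandwidth d cN N k) := by
        gcongr
        exact hwidth.2
    _ = _ := by
        rw [Real.sqrt_div hc0.le, Real.sqrt_sq hr0.le]
        field_simp

variable {Ω : Type*} [MeasurableSpace Ω] {μ : Measure Ω} [IsProbabilityMeasure μ]
  {Z : ℕ → ℕ → Ω → (Fin d → ℝ) × Bool}

lemma IsActiveSample.measure_cell_deviation_le
    (hact : IsActiveSample μ P (fun k ω => region P N δ cN m (fun j i => Z j i ω) k) Z)
    (hPi : HasDensityLowerBound μmin P.fst) (hμmin : 0 ≤ μmin) (hκ : 0 < κ) (hcN : 1 ≤ cN)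
    (hN : 3 ≤ N) (hδ : δ ∈ Ioc 0 1) (hm : IsRefining m)
    (hwidth : bandwidth d cN N k / κ ≤ 1 / (m k : ℝ))
    (hr : bandwidth d cN N k ^ 2 ≤ cellMassConst d μmin κ) (u : ℝ) (y : Fin d → ℝ) :
    μ {ω | u * √(labelCount P.fst (stepSize cN N k) (region P N δ cN m (fun j i => Z j i ω) k) *
        (P.fst.real (gridCell (m k) y) /
          P.fst.real (region P N δ cN m (fun j i => Z j i ω) k))) ≤
      |countDeviation
        (ProbabilityTheory.cond P (region P N δ cN m (fun j i => Z j i ω) k ×ˢ univ))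
        (gridCell (m k) y ×ˢ {true})
        fun i : Fin (labelCount P.fst (stepSize cN N k)
          (region P N δ cN m (fun j i => Z j i ω) k)) => Z k i ω|} ≤
      ENNReal.ofReal (2 * Real.exp (1 - u)) := by
  have hr0 : 0 < bandwidth d cN N k := bandwidth_pos hcN (by omega) k
  have hreg (ω : Ω) : MeasurableSet (region P N δ cN m (fun j i => Z j i ω) k) :=
    (isCellUnion_region hm k).measurableSet
  refine hact.measure_le_abs_countDeviation_le (factorsCountably_region Z k)
    (fun ω => prod_univ_ne_zero_of_fst_real_pos (hreg ω) (hr0.trans_le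
      (bandwidth_le_real_region hcN hN hδ hm hPi.real_unitCube k)))
    ((measurableSet_gridCell _ _).prod (measurableSet_singleton _))
    (fun B => labelCount P.fst (stepSize cN N k) B)
    (fun B => labelCount P.fst (stepSize cN N k) B *
      (P.fst.real (gridCell (m k) y) / P.fst.real B)) (fun ω => ?_) (fun ω => ?_) u
  · refine le_trans ?_ (hPi.cellMassConst_div_le hμmin hκ hcN hN hδ hm hwidth _ y)
    rwa [le_div_iff₀ (by positivity), one_mul]
  · gcongr
    exact cond_real_prod_le (hreg ω) (measurableSet_gridCell _ _)

lemma IsActiveSample.measure_not_isAccurateStep_le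
    (hact : IsActiveSample μ P (fun k ω => region P N δ cN m (fun j i => Z j i ω) k) Z)
    (h : IsRegressionFunction P η) (hs0 : 0 ≤ s) (hs : IsSmooth s η)
    (hPi : HasDensityLowerBound μmin P.fst) (hμmin : 0 < μmin) (hκ : 0 < κ) (hcN : 1 ≤ cN)
    (hN : 3 ≤ N) (hδ : δ ∈ Ioc 0 1) (hm : IsRefining m)
    (hwidth : 1 / (m k : ℝ) ∈ Icc (bandwidth d cN N k / κ) (κ * bandwidth d cN N k))
    (hr : bandwidth d cN N k ^ 2 ≤ cellMassConst d μmin κ) {u : ℝ} (hu : 0 ≤ u) :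
    μ {ω | ¬ IsAccurateStep P N δ cN m (fun j i => Z j i ω) η k
        ((u / √(cellMassConst d μmin κ) + s * κ) * bandwidth d cN N k)} ≤
      ENNReal.ofReal (κ ^ d * stepSize cN N k * (2 * Real.exp (1 - u))) := by
  obtain ⟨F, hFcard, hF⟩ := exists_finset_gridCell_eq (d := d) (hm.pos k)
  have hbad := fun y =>
    hact.measure_cell_deviation_le hPi hμmin.le hκ hcN hN hδ hm hwidth.1 hr u y
  refine (measure_mono ?_).trans ((measure_biUnion_finset_le F _).trans
    ((Finset.sum_le_sum fun y _ => hbad y).trans ?_))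
  · intro ω hω
    by_contra hnot
    refine hω (isAccurateStep_of_abs_countDeviation_le h hs0 hs hPi hμmin hκ hcN hN hδ hm hwidth
      hu fun x => ?_)
    obtain ⟨y, hy, hyx⟩ := hF x
    rw [← hyx]
    exact le_of_not_ge fun hge => hnot (mem_biUnion hy hge)
  · rw [Finset.sum_const, nsmul_eq_mul, ← ENNReal.ofReal_natCast,
      ← ENNReal.ofReal_mul (Nat.cast_nonneg _)]
    refine ENNReal.ofReal_le_ofReal (mul_le_mul_of_nonneg_right ?_ (by positivity))
    calc (F.card : ℝ) ≤ (m k : ℝ) ^ d := by exact_mod_cast hFcard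
      _ ≤ κ ^ d * stepSize cN N k := pow_le_mul_stepSize hcN (by omega) hκ (hm.pos k) hwidth.1

end StepAccuracy

/-! ### Uncertain regions after an accurate step -/

section ScoreDensity

variable {d : ℕ} {Pi : Measure (Fin d → ℝ)} {C Δ : ℝ}

lemma HasBoundedScoreDensity.real_abs_sub_le {f : (Fin d → ℝ) → ℝ}
    (hC : HasBoundedScoreDensity C Pi f) (hf : AEMeasurable f Pi) (hΔ : 0 ≤ Δ) (a : ℝ) :
    Pi.real {x | |f x - a| ≤ Δ} ≤ 2 * C * Δ := by
  have hset : {x | |f x - a| ≤ Δ} = {x | f x ∈ Icc (a - Δ) (a + Δ)} := by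
    ext x
    rw [mem_ofPred_eq, mem_ofPred_eq, abs_sub_comm, mem_Icc_iff_abs_le]
  rw [hset]
  exact (hC.real_mem_Icc_le hf (by linarith)).trans_eq (by ring)

lemma HasBoundedScoreDensity.real_abs_sub_half_le {η : (Fin d → ℝ) → ℝ}
    (hC : HasBoundedScoreDensity C Pi (score η)) (hη : AEMeasurable η Pi) (hΔ : 0 ≤ Δ) :
    Pi.real {x | |η x - 1 / 2| ≤ Δ} ≤ C * Δ := by
  have hset : {x | |η x - 1 / 2| ≤ Δ} = {x | score η x ∈ Icc (1 / 2) (1 / 2 + Δ)} := by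
    ext x
    simp only [mem_ofPred_eq, score_eq, mem_Icc, add_le_add_iff_left, le_add_iff_nonneg_right,
      abs_nonneg, true_and]
  rw [hset]
  exact (hC.real_mem_Icc_le (aemeasurable_score hη) (by linarith)).trans_eq (by ring)

-- The level set of `f` at the threshold, where `f` may have an atom, lies in a thin level band of
-- `g`, which has none.
lemma HasBoundedScoreDensity.real_le_threshold_le [IsFiniteMeasure Pi] {f g : (Fin d → ℝ) → ℝ}
    {A : Set (Fin d → ℝ)} {ε : ℝ} (hC : HasBoundedScoreDensity C Pi g) (hg : AEMeasurable g Pi)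
    (hΔ : 0 ≤ Δ) (hε : 0 ≤ ε) (hfg : ∀ x ∈ A, |f x - g x| ≤ Δ) :
    Pi.real {x | x ∈ A ∧ (f x : EReal) ≤ threshold Pi A f ε} ≤ ε + 2 * C * Δ := by
  have hatom : Pi.real {x | x ∈ A ∧ (f x : EReal) = threshold Pi A f ε} ≤ 2 * C * Δ := by
    rcases eq_empty_or_nonempty {x | x ∈ A ∧ (f x : EReal) = threshold Pi A f ε} with
      hempty | ⟨y, -, hy⟩
    · rw [hempty, measureReal_empty]
      have := hC.nonneg
      positivity
    · refine (measureReal_mono ?_).trans (hC.real_abs_sub_le hg hΔ (f y))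
      rintro x ⟨hxA, hx⟩
      have hxy : f x = f y := EReal.coe_injective (hx.trans hy.symm)
      simpa only [mem_ofPred_eq, ← hxy, abs_sub_comm] using hfg x hxA
  refine (measureReal_mono fun x hx => ?_).trans ((measureReal_union_le _ _).trans
    (add_le_add (real_lt_threshold_le hε) hatom))
  exact hx.2.lt_or_eq.imp (⟨hx.1, ·⟩) (⟨hx.1, ·⟩)

end ScoreDensity

section AccurateStep

lemma le_iff_le_of_abs_sub_lt {a b c : ℝ} (h : |a - b| < |b - c|) : c ≤ a ↔ c ≤ b := by
  have hab := abs_lt.1 h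
  rcases abs_cases (b - c) with ⟨hbc, _⟩ | ⟨hbc, _⟩ <;> constructor <;> intro <;> linarith

variable {d N : ℕ} {cN δ : ℝ} {P : Measure ((Fin d → ℝ) × Bool)} [IsProbabilityMeasure P]
  {m : ℕ → ℕ} {D : ℕ → ℕ → (Fin d → ℝ) × Bool} {η : (Fin d → ℝ) → ℝ} {C Δ : ℝ} {k : ℕ}

-- If `x` leaves the region within `Δ` of the decision boundary, then every point of the region with
-- a smaller estimated score is within `3Δ` of it, so too few points lie below the threshold.
lemma half_le_stepEstimator_iff (hη : AEMeasurable η P.fst)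
    (hC : HasBoundedScoreDensity C P.fst (score η)) (hΔ : 0 ≤ Δ)
    (hε : min 1 (3 * C * Δ) ≤ rejectionRate d cN N δ (k + 1))
    (hacc : IsAccurateStep P N δ cN m D η k Δ) {x : Fin d → ℝ}
    (hx : x ∈ region P N δ cN m D k) (hx' : x ∉ region P N δ cN m D (k + 1)) :
    1 / 2 ≤ stepEstimator P N δ cN m D k x ↔ 1 / 2 ≤ η x := by
  refine le_iff_le_of_abs_sub_lt ((hacc x hx).trans_lt ?_)
  by_contra! hnear
  set f := score (stepEstimator P N δ cN m D k)
  have hbelow : threshold P.fst (region P N δ cN m D k) f (rejectionRate d cN N δ (k + 1)) < f x :=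
    not_le.1 fun hle => hx' ⟨hx, hle⟩
  have hscore (z : Fin d → ℝ) (hz : z ∈ region P N δ cN m D k) : |f z - score η z| ≤ Δ :=
    (abs_score_sub_score_le z).trans (hacc z hz)
  have hsub : {z | z ∈ region P N δ cN m D k ∧ (f z : EReal) ≤ f x} ⊆
      {z | |η z - 1 / 2| ≤ 3 * Δ} := by
    rintro z ⟨hz, hzx⟩
    have hzx : f z ≤ f x := EReal.coe_le_coe_iff.1 hzx
    have hfz := (abs_le.1 (hscore z hz)).1
    have hfx := (abs_le.1 (hscore x hx)).2
    rw [score_eq] at hfz hfx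
    exact mem_ofPred_eq ▸ (by linarith)
  refine (lt_real_of_threshold_lt hbelow).not_ge (le_trans (le_min measureReal_le_one ?_) hε)
  exact ((measureReal_mono hsub).trans (hC.real_abs_sub_half_le hη (by linarith))).trans_eq
    (by ring)

lemma real_region_succ_le (hη : AEMeasurable η P.fst)
    (hC : HasBoundedScoreDensity C P.fst (score η)) (hΔ : 0 ≤ Δ)
    (hε : 0 ≤ rejectionRate d cN N δ (k + 1)) (hacc : IsAccurateStep P N δ cN m D η k Δ) :
    P.fst.real (region P N δ cN m D (k + 1)) ≤ rejectionRate d cN N δ (k + 1) + 2 * C * Δ :=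
  hC.real_le_threshold_le (aemeasurable_score hη) hΔ hε fun x hx =>
    (abs_score_sub_score_le x).trans (hacc x hx)

end AccurateStep

/-! ### The final classifier -/

section FinalEstimator

variable {d N : ℕ} {cN δ : ℝ} {P : Measure ((Fin d → ℝ) × Bool)}
  {m : ℕ → ℕ} {D : ℕ → ℕ → (Fin d → ℝ) × Bool} {x : Fin d → ℝ}

lemma finalEstimator_of_mem_sdiff {j : ℕ} (hj : j < lastStep P N δ cN m D)
    (hx : x ∈ region P N δ cN m D j) (hx' : x ∉ region P N δ cN m D (j + 1)) :
    finalEstimator P N δ cN m D x = stepEstimator P N δ cN m D j x := by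
  have hother : ∀ i ∈ Finset.range (lastStep P N δ cN m D), i ≠ j →
      (region P N δ cN m D i \ region P N δ cN m D (i + 1)).indicator
        (stepEstimator P N δ cN m D i) x = 0 := fun i _ hij => by
    refine indicator_of_notMem (fun hi => ?_) _
    rcases hij.lt_or_gt with hlt | hgt
    · exact hi.2 (region_anti (Nat.succ_le_of_lt hlt) hx)
    · exact hx' (region_anti (Nat.succ_le_of_lt hgt) hi.1)
  rw [finalEstimator, Finset.sum_eq_single_of_mem j (Finset.mem_range.2 hj) hother,
    indicator_of_mem ((mem_sdiff x).2 ⟨hx, hx'⟩),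
    indicator_of_notMem fun h => hx' (region_anti (Nat.succ_le_of_lt hj) h), add_zero]

lemma finalEstimator_of_mem (hx : x ∈ region P N δ cN m D (lastStep P N δ cN m D)) :
    finalEstimator P N δ cN m D x = stepEstimator P N δ cN m D (lastStep P N δ cN m D) x := by
  rw [finalEstimator, indicator_of_mem hx, Finset.sum_eq_zero fun i hi => ?_, zero_add]
  exact indicator_of_notMem
    (fun h => h.2 (region_anti (Nat.succ_le_of_lt (Finset.mem_range.1 hi)) hx)) _

lemma exists_mem_sdiff_of_notMem (hx : x ∈ unitCube d) {k : ℕ}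
    (hk : x ∉ region P N δ cN m D k) :
    ∃ j < k, x ∈ region P N δ cN m D j ∧ x ∉ region P N δ cN m D (j + 1) := by
  induction k with
  | zero => exact absurd hx hk
  | succ k ih =>
    by_cases hxk : x ∈ region P N δ cN m D k
    · exact ⟨k, k.lt_succ_self, hxk, hk⟩
    · obtain ⟨j, hj, hxj⟩ := ih hxk
      exact ⟨j, hj.trans k.lt_succ_self, hxj⟩

lemma measurable_finalEstimator (hm : IsRefining m) : Measurable (finalEstimator P N δ cN m D) := by
  have hreg (k : ℕ) : MeasurableSet (region P N δ cN m D k) :=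
    (isCellUnion_region hm k).measurableSet
  exact (Finset.measurable_sum _ fun j _ =>
    (measurable_stepEstimator j).indicator ((hreg j).diff (hreg (j + 1)))).add
    ((measurable_stepEstimator _).indicator (hreg _))

end FinalEstimator

/-! ### The last step -/

section LastStep

variable {d N : ℕ} {cN δ : ℝ} {P : Measure ((Fin d → ℝ) × Bool)} [IsProbabilityMeasure P]
  {m : ℕ → ℕ} {D : ℕ → ℕ → (Fin d → ℝ) × Bool}

lemma stepSize_mul_bandwidth_le_of_labelsUsed_le (hcN : 1 ≤ cN) (hN : 3 ≤ N) (hδ : δ ∈ Ioc 0 1)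
    (hm : IsRefining m) (hcube : P.fst.real (unitCube d) = 1) {k : ℕ}
    (hk : labelsUsed P N δ cN m D k ≤ N) :
    (stepSize cN N k : ℝ) * bandwidth d cN N k ≤ 2 * N := by
  have hcount : labelCount P.fst (stepSize cN N k) (region P N δ cN m D k) ≤ N :=
    (Finset.single_le_sum (f := fun j => labelCount P.fst (stepSize cN N j)
      (region P N δ cN m D j)) (fun _ _ => Nat.zero_le _) (Finset.self_mem_range_succ k)).trans hk
  calc (stepSize cN N k : ℝ) * bandwidth d cN N k
      ≤ stepSize cN N k * P.fst.real (region P N δ cN m D k) := by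
        gcongr
        exact bandwidth_le_real_region hcN hN hδ hm hcube k
    _ ≤ 2 * labelCount P.fst (stepSize cN N k) (region P N δ cN m D k) := by
        have := half_le_labelCount_region (D := D) hcN hN hδ hm hcube k
        linarith
    _ ≤ 2 * N := by gcongr

lemma two_mul_pow_add_two_le {n : ℕ} (hd : 1 ≤ d) (hn : 8 ≤ n) :
    (2 * n) ^ (d + 2) ≤ (n ^ 2) ^ (d + 1) := by
  have htwo : 2 ^ (d + 2) ≤ n ^ d :=
    calc 2 ^ (d + 2) ≤ 2 ^ (3 * d) := Nat.pow_le_pow_right two_pos (by omega)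
      _ = 8 ^ d := by rw [pow_mul]; norm_num
      _ ≤ n ^ d := Nat.pow_le_pow_left hn d
  calc (2 * n) ^ (d + 2) = 2 ^ (d + 2) * n ^ (d + 2) := mul_pow _ _ _
    _ ≤ n ^ d * n ^ (d + 2) := Nat.mul_le_mul_right _ htwo
    _ = (n ^ 2) ^ (d + 1) := by ring

lemma stepSize_le_sq_of_labelsUsed_le (hd : 1 ≤ d) (hcN : 1 ≤ cN) (hN : 8 ≤ N)
    (hδ : δ ∈ Ioc 0 1) (hm : IsRefining m) (hcube : P.fst.real (unitCube d) = 1) {k : ℕ}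
    (hk : labelsUsed P N δ cN m D k ≤ N) : stepSize cN N k ≤ N ^ 2 := by
  have hN1 : 1 ≤ N := by omega
  have hr := (bandwidth_pos (d := d) hcN hN1 k).le
  have hpow : (stepSize cN N k : ℝ) ^ (d + 1) ≤ (2 * N) ^ (d + 2) := by
    rw [← stepSize_mul_bandwidth_pow_eq hcN hN1]
    exact pow_le_pow_left₀ (by positivity)
      (stepSize_mul_bandwidth_le_of_labelsUsed_le hcN (by omega) hδ hm hcube hk) _
  refine le_of_pow_le_pow_left₀ (n := d + 1) (by omega) (Nat.zero_le _) (le_trans ?_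
    (two_mul_pow_add_two_le hd hN))
  exact_mod_cast hpow

lemma labelsUsed_zero_le : labelsUsed P N δ cN m D 0 ≤ N := by
  simp only [labelsUsed, zero_add, Finset.sum_range_one]
  exact (labelCount_le _ _).trans (Nat.sqrt_le_self N)

lemma bddAbove_labelsUsed_le (hB : IsLargeBudget cN N) (hd : 1 ≤ d) (hδ : δ ∈ Ioc 0 1)
    (hm : IsRefining m) (hcube : P.fst.real (unitCube d) = 1) :
    BddAbove {k | labelsUsed P N δ cN m D k ≤ N} :=
  ⟨N ^ 2, fun k hk => (hB.strictMono_stepSize.le_apply (x := k)).trans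
    (stepSize_le_sq_of_labelsUsed_le hd hB.one_lt_growth.le hB.eight_le hδ hm hcube hk)⟩

lemma labelsUsed_lastStep_le (hB : IsLargeBudget cN N) (hd : 1 ≤ d) (hδ : δ ∈ Ioc 0 1)
    (hm : IsRefining m) (hcube : P.fst.real (unitCube d) = 1) :
    labelsUsed P N δ cN m D (lastStep P N δ cN m D) ≤ N :=
  Nat.sSup_mem (s := {k | labelsUsed P N δ cN m D k ≤ N}) ⟨0, labelsUsed_zero_le⟩
    (bddAbove_labelsUsed_le hB hd hδ hm hcube)

lemma lt_labelsUsed_lastStep_add_one (hB : IsLargeBudget cN N) (hd : 1 ≤ d) (hδ : δ ∈ Ioc 0 1)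
    (hm : IsRefining m) (hcube : P.fst.real (unitCube d) = 1) :
    N < labelsUsed P N δ cN m D (lastStep P N δ cN m D + 1) := by
  by_contra! hle
  exact (Nat.lt_succ_self _).not_ge
    (le_csSup (bddAbove_labelsUsed_le (D := D) hB hd hδ hm hcube) hle)

end LastStep

/-! ### Excess risk after accurate steps -/

section ExcessRisk

variable {d N : ℕ} {cN δ : ℝ} {P : Measure ((Fin d → ℝ) × Bool)} [IsProbabilityMeasure P]
  {m : ℕ → ℕ} {D : ℕ → ℕ → (Fin d → ℝ) × Bool} {η : (Fin d → ℝ) → ℝ} {C : ℝ} {Δ : ℕ → ℝ}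

lemma abs_sub_half_le_of_activeClassifier_ne (hη : AEMeasurable η P.fst)
    (hC : HasBoundedScoreDensity C P.fst (score η)) (hΔ : ∀ k, 0 ≤ Δ k)
    (hε : ∀ k, min 1 (3 * C * Δ k) ≤ rejectionRate d cN N δ (k + 1))
    (hacc : ∀ k ≤ lastStep P N δ cN m D, IsAccurateStep P N δ cN m D η k (Δ k))
    {x : Fin d → ℝ} (hx : x ∈ unitCube d)
    (hne : activeClassifier P N δ cN m D x ≠ plugIn η x) :
    |η x - 1 / 2| ≤ Δ (lastStep P N δ cN m D) := by
  by_cases hxL : x ∈ region P N δ cN m D (lastStep P N δ cN m D)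
  · by_contra! hfar
    refine hne ?_
    simp only [activeClassifier, plugIn, finalEstimator_of_mem hxL,
      le_iff_le_of_abs_sub_lt ((hacc _ le_rfl x hxL).trans_lt hfar)]
  · obtain ⟨j, hj, hxj, hxj'⟩ := exists_mem_sdiff_of_notMem hx hxL
    refine absurd ?_ hne
    simp only [activeClassifier, plugIn, finalEstimator_of_mem_sdiff hj hxj hxj',
      half_le_stepEstimator_iff hη hC (hΔ j) (hε j) (hacc j hj.le) hxj hxj']

lemma risk_activeClassifier_sub_le_sq (h : IsRegressionFunction P η)
    (hC : HasBoundedScoreDensity C P.fst (score η)) (hcube : ∀ᵐ x ∂P.fst, x ∈ unitCube d)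
    (hm : IsRefining m) (hΔ : ∀ k, 0 ≤ Δ k)
    (hε : ∀ k, min 1 (3 * C * Δ k) ≤ rejectionRate d cN N δ (k + 1))
    (hacc : ∀ k ≤ lastStep P N δ cN m D, IsAccurateStep P N δ cN m D η k (Δ k)) :
    risk P (activeClassifier P N δ cN m D) - risk P (plugIn η) ≤
      2 * C * Δ (lastStep P N δ cN m D) ^ 2 := by
  set b := Δ (lastStep P N δ cN m D)
  have hb : 0 ≤ b := hΔ _
  have hne : ∀ᵐ x ∂P.fst, activeClassifier P N δ cN m D x ≠ plugIn η x → |η x - 1 / 2| ≤ b := by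
    filter_upwards [hcube] with x hx
    exact abs_sub_half_le_of_activeClassifier_ne h.aemeasurable hC hΔ hε hacc hx
  calc risk P (activeClassifier P N δ cN m D) - risk P (plugIn η)
      ≤ 2 * b * P.fst.real {x | activeClassifier P N δ cN m D x ≠ plugIn η x} :=
        h.risk_sub_risk_le (aemeasurable_plugIn h.aemeasurable)
          (aemeasurable_plugIn (measurable_finalEstimator hm).aemeasurable) hb hne
    _ ≤ 2 * b * P.fst.real {x | |η x - 1 / 2| ≤ b} := by
        exact mul_le_mul_of_nonneg_left
          (ENNReal.toReal_mono (measure_ne_top _ _) (measure_mono_ae hne)) (by positivity)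
    _ ≤ 2 * b * (C * b) := by
        gcongr
        exact hC.real_abs_sub_half_le h.aemeasurable hb
    _ = 2 * C * b ^ 2 := by ring

end ExcessRisk

/-! ### The bandwidth at the last step -/

section Rate

variable {d N : ℕ} {cN δ : ℝ}

lemma sq_le_mul_rpow_of_mul_pow_le {r n b : ℝ} (hd : 1 ≤ d) (hr : 0 ≤ r) (hn : 0 < n) (hb : 1 ≤ b)
    (h : n * r ^ (d + 1) ≤ b) : r ^ 2 ≤ b * n ^ (-(2 / (1 + (d : ℝ)))) := by
  set e : ℝ := 2 / (1 + (d : ℝ))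
  have he1 : e ≤ 1 := by
    rw [div_le_one (by positivity)]
    linarith [Nat.one_le_cast (α := ℝ).2 hd]
  have hde : ((d + 1 : ℕ) : ℝ) * e = (2 : ℕ) := by
    push_cast
    simp only [e]
    field_simp
    ring
  calc r ^ 2 = (r ^ (d + 1)) ^ e := by
        rw [← Real.rpow_natCast_mul hr, hde, Real.rpow_natCast]
    _ ≤ (b / n) ^ e := by
        gcongr
        rwa [le_div_iff₀' hn]
    _ = b ^ e * n ^ (-e) := by
        rw [Real.div_rpow (by linarith) hn.le, Real.rpow_neg hn.le, div_eq_mul_inv]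
    _ ≤ b * n ^ (-e) := by
        gcongr
        exact Real.rpow_le_self_of_one_le hb he1

/-- The constant in the bound `N ≤ growthConst cN * log (N / δ) ^ 3 * N_L * r_L` for the last step
`L`. Its logarithm bounds the number of steps, the step sizes growing by a factor at least
`(1 + cN) / 2`. -/
noncomputable def growthConst (cN : ℝ) : ℝ := 4 * cN * (2 / Real.log ((1 + cN) / 2) + 1)

lemma one_le_growthConst (hcN : 1 < cN) : 1 ≤ growthConst cN := by
  have hlog : 0 < Real.log ((1 + cN) / 2) := Real.log_pos (by linarith)
  exact one_le_mul_of_one_le_of_one_le (by linarith) (le_add_of_nonneg_left (by positivity))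

lemma IsLargeBudget.add_one_le_mul_log (hB : IsLargeBudget cN N) {k : ℕ}
    (hk : stepSize cN N k ≤ N ^ 2) :
    (k : ℝ) + 1 ≤ (2 / Real.log ((1 + cN) / 2) + 1) * Real.log N := by
  have hcN := hB.one_lt_growth
  have hpow : ((1 + cN) / 2) ^ k ≤ (N : ℝ) ^ 2 :=
    (hB.pow_le_stepSize k).trans (by exact_mod_cast hk)
  have hlog := Real.log_le_log (by positivity) hpow
  rw [Real.log_pow, Real.log_pow] at hlog
  have hk : (k : ℝ) ≤ 2 / Real.log ((1 + cN) / 2) * Real.log N := by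
    rw [div_mul_eq_mul_div, le_div_iff₀ (Real.log_pos (by linarith))]
    exact_mod_cast hlog
  linarith [one_le_log_natCast hB.three_le]

variable {P : Measure ((Fin d → ℝ) × Bool)} [IsProbabilityMeasure P] {m : ℕ → ℕ}
  {D : ℕ → ℕ → (Fin d → ℝ) × Bool} {k : ℕ}

lemma two_mul_labelCount_zero_le (hN : 4 ≤ N) (A : Set (Fin d → ℝ)) :
    2 * labelCount P.fst (stepSize cN N 0) A ≤ N :=
  calc 2 * labelCount P.fst (stepSize cN N 0) A ≤ Nat.sqrt N * Nat.sqrt N :=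
        Nat.mul_le_mul (Nat.le_sqrt.2 hN) (labelCount_le _ _)
    _ ≤ N := Nat.sqrt_le N

lemma labelsUsed_succ_le {c : ℝ} (hcN : 1 ≤ cN) (hN : 4 ≤ N) (hc : 0 ≤ c)
    (hreg : ∀ j ≤ k, P.fst.real (region P N δ cN m D (j + 1)) ≤ c * bandwidth d cN N j) :
    (labelsUsed P N δ cN m D (k + 1) : ℝ) ≤
      N / 2 + (k + 1) * (cN * c * (stepSize cN N k * bandwidth d cN N k)) := by
  have hzero : 2 * (labelCount P.fst (stepSize cN N 0) (region P N δ cN m D 0) : ℝ) ≤ N := by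
    exact_mod_cast two_mul_labelCount_zero_le hN _
  have hstep : ∀ j ∈ Finset.range (k + 1),
      (labelCount P.fst (stepSize cN N (j + 1)) (region P N δ cN m D (j + 1)) : ℝ) ≤
        cN * c * (stepSize cN N k * bandwidth d cN N k) := fun j hj => by
    have hjk : j ≤ k := Nat.lt_succ_iff.1 (Finset.mem_range.1 hj)
    calc (labelCount P.fst (stepSize cN N (j + 1)) (region P N δ cN m D (j + 1)) : ℝ)
        ≤ stepSize cN N (j + 1) * P.fst.real (region P N δ cN m D (j + 1)) :=
          Nat.floor_le (by positivity)
      _ ≤ (cN * stepSize cN N j) * (c * bandwidth d cN N j) :=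
          mul_le_mul (stepSize_succ_le hcN j) (hreg j hjk) measureReal_nonneg (by positivity)
      _ = cN * c * (stepSize cN N j * bandwidth d cN N j) := by ring
      _ ≤ _ := mul_le_mul_of_nonneg_left
          (stepSize_mul_bandwidth_mono hcN (by omega) hjk) (by positivity)
  have hsum := Finset.sum_le_card_nsmul _ _ _ hstep
  rw [Finset.card_range, nsmul_eq_mul] at hsum
  rw [labelsUsed, Finset.sum_range_succ']
  push_cast at hsum ⊢
  linarith

lemma natCast_le_growthConst_mul (hB : IsLargeBudget cN N) (hδ : δ ∈ Ioc 0 1)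
    (hk : stepSize cN N k ≤ N ^ 2) (hused : N < labelsUsed P N δ cN m D (k + 1))
    (hreg : ∀ j ≤ k, P.fst.real (region P N δ cN m D (j + 1)) ≤
      2 * (Real.log ((N : ℝ) / δ) * Real.log N) * bandwidth d cN N j) :
    (N : ℝ) ≤ growthConst cN * Real.log ((N : ℝ) / δ) ^ 3 *
      (stepSize cN N k * bandwidth d cN N k) := by
  have hcN := hB.one_lt_growth
  set ℓ := Real.log ((N : ℝ) / δ)
  set a := (stepSize cN N k : ℝ) * bandwidth d cN N k
  have ha : 0 ≤ a := mul_nonneg (Nat.cast_nonneg _) (bandwidth_pos hcN.le hB.one_le k).le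
  have hlog : 0 ≤ Real.log N := Real.log_natCast_nonneg N
  have hlogℓ : Real.log N ≤ ℓ := log_le_log_div hδ
  have hℓ : 0 ≤ ℓ := hlog.trans hlogℓ
  have hb : 0 < Real.log ((1 + cN) / 2) := Real.log_pos (by linarith)
  have hcount := labelsUsed_succ_le hcN.le (le_trans (by norm_num) hB.eight_le) (by positivity) hreg
  have hused : (N : ℝ) < labelsUsed P N δ cN m D (k + 1) := Nat.cast_lt.2 hused
  have hsteps : (k + 1 : ℝ) * (cN * (2 * (ℓ * Real.log N)) * a) ≤
      ((2 / Real.log ((1 + cN) / 2) + 1) * ℓ) * (cN * (2 * (ℓ * ℓ)) * a) := by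
    gcongr
    exact (hB.add_one_le_mul_log hk).trans (by gcongr)
  unfold growthConst
  linarith

lemma bandwidth_sq_le (hB : IsLargeBudget cN N) (hd : 1 ≤ d) (hδ : δ ∈ Ioc 0 1)
    (hk : (N : ℝ) ≤ growthConst cN * Real.log ((N : ℝ) / δ) ^ 3 *
      (stepSize cN N k * bandwidth d cN N k)) :
    bandwidth d cN N k ^ 2 ≤ growthConst cN * Real.log ((N : ℝ) / δ) ^ 3 *
      (N : ℝ) ^ (-(2 / (1 + (d : ℝ)))) := by
  have hcN := hB.one_lt_growth
  have hr := bandwidth_pos (d := d) hcN.le hB.one_le k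
  have hℓ : 1 ≤ Real.log ((N : ℝ) / δ) :=
    (one_le_log_natCast hB.three_le).trans (log_le_log_div hδ)
  refine sq_le_mul_rpow_of_mul_pow_le hd hr.le (Nat.cast_pos.2 hB.one_le)
    (one_le_mul_of_one_le_of_one_le (one_le_growthConst hcN) (one_le_pow₀ hℓ)) ?_
  calc (N : ℝ) * bandwidth d cN N k ^ (d + 1)
      ≤ growthConst cN * Real.log ((N : ℝ) / δ) ^ 3 *
        (stepSize cN N k * bandwidth d cN N k) * bandwidth d cN N k ^ (d + 1) := by gcongr
    _ = growthConst cN * Real.log ((N : ℝ) / δ) ^ 3 *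
        (stepSize cN N k * bandwidth d cN N k ^ (d + 2)) := by ring
    _ = growthConst cN * Real.log ((N : ℝ) / δ) ^ 3 := by
        rw [stepSize_mul_bandwidth_pow hcN.le hB.one_le, mul_one]

variable {μmin C c : ℝ} {η : (Fin d → ℝ) → ℝ}

lemma risk_activeClassifier_sub_le (hB : IsLargeBudget cN N) (hd : 1 ≤ d) (hδ : δ ∈ Ioc 0 1)
    (hm : IsRefining m) (h : IsRegressionFunction P η) (hPi : HasDensityLowerBound μmin P.fst)
    (hC : HasBoundedScoreDensity C P.fst (score η)) (hc : 0 ≤ c) (hlog : 3 * C * c ≤ Real.log N)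
    (hacc : ∀ k, stepSize cN N k ≤ N ^ 2 →
      IsAccurateStep P N δ cN m D η k (c * Real.log ((N : ℝ) / δ) * bandwidth d cN N k)) :
    risk P (activeClassifier P N δ cN m D) - risk P (plugIn η) ≤
      2 * C * c ^ 2 * growthConst cN * Real.log ((N : ℝ) / δ) ^ 5 *
        (N : ℝ) ^ (-(2 / (1 + (d : ℝ)))) := by
  have hcN := hB.one_lt_growth.le
  have hC0 := hC.nonneg
  have hr (k : ℕ) : 0 < bandwidth d cN N k := bandwidth_pos hcN hB.one_le k
  set ℓ := Real.log ((N : ℝ) / δ)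
  have hℓ : 0 ≤ ℓ := log_div_nonneg hδ
  set L := lastStep P N δ cN m D
  have hNL : stepSize cN N L ≤ N ^ 2 := stepSize_le_sq_of_labelsUsed_le hd hcN hB.eight_le hδ hm
    hPi.real_unitCube (labelsUsed_lastStep_le hB hd hδ hm hPi.real_unitCube)
  have haccL (k : ℕ) (hk : k ≤ L) := hacc k ((stepSize_mono hcN hk).trans hNL)
  have hΔ (k : ℕ) : 0 ≤ c * ℓ * bandwidth d cN N k := by have := (hr k).le; positivity
  have hCΔ (k : ℕ) : 3 * C * (c * ℓ * bandwidth d cN N k) ≤ ℓ * Real.log N * bandwidth d cN N k :=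
    calc _ = 3 * C * c * (ℓ * bandwidth d cN N k) := by ring
      _ ≤ Real.log N * (ℓ * bandwidth d cN N k) := by have := (hr k).le; gcongr
      _ = _ := by ring
  have hreg (k : ℕ) (hk : k ≤ L) : P.fst.real (region P N δ cN m D (k + 1)) ≤
      2 * (ℓ * Real.log N) * bandwidth d cN N k := by
    have hmass := real_region_succ_le h.aemeasurable hC (hΔ k)
      (rejectionRate_nonneg hcN hB.one_le hδ (k + 1)) (haccL k hk)
    have hrate := (rejectionRate_succ (d := d) (cN := cN) (N := N) (δ := δ) k).trans_le
      (min_le_right _ _)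
    linarith [hCΔ k, mul_nonneg hC0 (hΔ k)]
  have hrisk := risk_activeClassifier_sub_le_sq h hC hPi.ae_mem_unitCube hm hΔ
    (fun k => (min_le_min le_rfl (hCΔ k)).trans_eq (rejectionRate_succ k).symm) haccL
  have hrL := bandwidth_sq_le hB hd hδ (natCast_le_growthConst_mul hB hδ hNL
    (lt_labelsUsed_lastStep_add_one hB hd hδ hm hPi.real_unitCube) hreg)
  calc _ ≤ 2 * C * c ^ 2 * ℓ ^ 2 * bandwidth d cN N L ^ 2 := hrisk.trans_eq (by ring)
    _ ≤ 2 * C * c ^ 2 * ℓ ^ 2 *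
        (growthConst cN * ℓ ^ 3 * (N : ℝ) ^ (-(2 / (1 + (d : ℝ))))) := by gcongr
    _ = _ := by ring

end Rate

/-! ### Accuracy of all steps and the budget threshold -/

section Event

lemma exists_measurableSet_compl_of_measure_le {Ω : Type*} [MeasurableSpace Ω] {μ : Measure Ω}
    [IsProbabilityMeasure μ] {B : Set Ω} {δ : ℝ} (hδ : 0 ≤ δ) (hB : μ B ≤ ENNReal.ofReal δ) :
    ∃ E, MeasurableSet E ∧ ENNReal.ofReal (1 - δ) ≤ μ E ∧ ∀ ω ∈ E, ω ∉ B := by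
  refine ⟨(toMeasurable μ B)ᶜ, (measurableSet_toMeasurable μ B).compl, ?_,
    fun ω hω hωB => hω (subset_toMeasurable μ B hωB)⟩
  rw [prob_compl_eq_one_sub (measurableSet_toMeasurable μ B), measure_toMeasurable,
    ENNReal.ofReal_sub _ hδ, ENNReal.ofReal_one]
  exact tsub_le_tsub_left hB 1

lemma union_bound_log_le {n δ a : ℝ} (hn : 1 ≤ n) (hδ : δ ∈ Ioc 0 1) (ha : 0 ≤ a)
    (han : 12 * a ≤ n) :
    (n ^ 2 + 1) * (a * n ^ 2 * (2 * Real.exp (1 - 6 * Real.log (n / δ)))) ≤ δ := by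
  obtain ⟨hδ0, hδ1⟩ := hδ
  have hexp : Real.exp (1 - 6 * Real.log (n / δ)) ≤ 3 * (δ / n) ^ 6 := by
    rw [sub_eq_add_neg, Real.exp_add, Real.exp_neg, ← Nat.cast_ofNat (n := 6), Real.exp_nat_mul,
      Real.exp_log (by positivity), ← inv_pow, inv_div]
    gcongr
    linarith [Real.exp_one_lt_d9]
  have hsq : n ^ 2 + 1 ≤ 2 * n ^ 2 := by linarith [one_le_pow₀ hn (n := 2)]
  calc (n ^ 2 + 1) * (a * n ^ 2 * (2 * Real.exp (1 - 6 * Real.log (n / δ))))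
      ≤ (2 * n ^ 2) * (a * n ^ 2 * (2 * (3 * (δ / n) ^ 6))) := by gcongr
    _ = 12 * a * δ ^ 6 / n ^ 2 := by
        field_simp
        ring
    _ ≤ n * δ / n ^ 2 := by
        gcongr
        exact pow_le_of_le_one hδ0.le hδ1 (by norm_num)
    _ = δ / n := by field_simp
    _ ≤ δ := div_le_self hδ0.le hn

/-- The constant in the error bound `accuracyConst d s μmin κ * log (N / δ) * r_k` for step `k`.
The first term is the deviation of the noise, the second the bias of a cell average; a deviation of
`6 * log (N / δ)` standard units leaves room for a union bound over all cells and steps. -/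
noncomputable def accuracyConst (d : ℕ) (s μmin κ : ℝ) : ℝ :=
  6 / √(cellMassConst d μmin κ) + s * κ

lemma accuracyConst_nonneg {d : ℕ} {s μmin κ : ℝ} (hs : 0 ≤ s) (hκ : 0 < κ) :
    0 ≤ accuracyConst d s μmin κ := by
  unfold accuracyConst
  positivity

variable {d N : ℕ} {cN δ s μmin κ : ℝ} {P : Measure ((Fin d → ℝ) × Bool)} [IsProbabilityMeasure P]
  {m : ℕ → ℕ} {η : (Fin d → ℝ) → ℝ} {Ω : Type*} [MeasurableSpace Ω] {μ : Measure Ω}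
  [IsProbabilityMeasure μ] {Z : ℕ → ℕ → Ω → (Fin d → ℝ) × Bool}

lemma IsActiveSample.measure_not_isAccurateStep_log_le {k : ℕ}
    (hact : IsActiveSample μ P (fun k ω => region P N δ cN m (fun j i => Z j i ω) k) Z)
    (h : IsRegressionFunction P η) (hs0 : 0 ≤ s) (hs : IsSmooth s η)
    (hPi : HasDensityLowerBound μmin P.fst) (hμmin : 0 < μmin) (hκ : 0 < κ) (hcN : 1 ≤ cN)
    (hN : 3 ≤ N) (hδ : δ ∈ Ioc 0 1) (hm : IsRefining m)
    (hwidth : 1 / (m k : ℝ) ∈ Icc (bandwidth d cN N k / κ) (κ * bandwidth d cN N k))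
    (hr : bandwidth d cN N k ^ 2 ≤ cellMassConst d μmin κ) :
    μ {ω | ¬ IsAccurateStep P N δ cN m (fun j i => Z j i ω) η k
        (accuracyConst d s μmin κ * Real.log ((N : ℝ) / δ) * bandwidth d cN N k)} ≤
      ENNReal.ofReal (κ ^ d * stepSize cN N k *
        (2 * Real.exp (1 - 6 * Real.log ((N : ℝ) / δ)))) := by
  set ℓ := Real.log ((N : ℝ) / δ)
  have hℓ : 1 ≤ ℓ := (one_le_log_natCast hN).trans (log_le_log_div hδ)
  have hr0 := bandwidth_pos (d := d) hcN (by omega : 1 ≤ N) k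
  have hconst : 6 * ℓ / √(cellMassConst d μmin κ) + s * κ ≤ accuracyConst d s μmin κ * ℓ :=
    calc _ ≤ 6 * ℓ / √(cellMassConst d μmin κ) + s * κ * ℓ := by
          gcongr 6 * ℓ / √(cellMassConst d μmin κ) + ?_
          exact le_mul_of_one_le_right (by positivity) hℓ
      _ = _ := by unfold accuracyConst; ring
  refine le_trans (measure_mono ?_) (hact.measure_not_isAccurateStep_le h hs0 hs hPi hμmin hκ hcN hN
    hδ hm hwidth hr (u := 6 * ℓ) (by positivity))
  intro ω hω hacc
  exact hω fun x hx => (hacc x hx).trans (mul_le_mul_of_nonneg_right hconst hr0.le)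

lemma IsActiveSample.measure_exists_not_isAccurateStep_le
    (hact : IsActiveSample μ P (fun k ω => region P N δ cN m (fun j i => Z j i ω) k) Z)
    (hB : IsLargeBudget cN N) (h : IsRegressionFunction P η) (hs0 : 0 ≤ s) (hs : IsSmooth s η)
    (hPi : HasDensityLowerBound μmin P.fst) (hμmin : 0 < μmin) (hκ : 0 < κ)
    (hδ : δ ∈ Ioc 0 1) (hm : IsRefining m)
    (hwidth : ∀ k, 1 / (m k : ℝ) ∈ Icc (bandwidth d cN N k / κ) (κ * bandwidth d cN N k))
    (hr : bandwidth d cN N 0 ^ 2 ≤ cellMassConst d μmin κ) (hκN : 12 * κ ^ d ≤ N) :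
    μ {ω | ∃ k, stepSize cN N k ≤ N ^ 2 ∧ ¬ IsAccurateStep P N δ cN m (fun j i => Z j i ω) η k
        (accuracyConst d s μmin κ * Real.log ((N : ℝ) / δ) * bandwidth d cN N k)} ≤
      ENNReal.ofReal δ := by
  have hcN := hB.one_lt_growth.le
  set bad : ℕ → Set Ω := fun k => {ω | ¬ IsAccurateStep P N δ cN m (fun j i => Z j i ω) η k
    (accuracyConst d s μmin κ * Real.log ((N : ℝ) / δ) * bandwidth d cN N k)}
  set steps := {k ∈ Finset.range (N ^ 2 + 1) | stepSize cN N k ≤ N ^ 2}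
  set a := κ ^ d * (N : ℝ) ^ 2 * (2 * Real.exp (1 - 6 * Real.log ((N : ℝ) / δ)))
  have hcover : {ω | ∃ k, stepSize cN N k ≤ N ^ 2 ∧ ω ∈ bad k} ⊆ ⋃ k ∈ steps, bad k := by
    rintro ω ⟨k, hk, hω⟩
    have hkN : k ≤ N ^ 2 := (hB.strictMono_stepSize.le_apply).trans hk
    exact mem_biUnion (Finset.mem_filter.2 ⟨Finset.mem_range.2 (Nat.lt_succ_of_le hkN), hk⟩) hω
  have hbad : ∀ k ∈ steps, μ (bad k) ≤ ENNReal.ofReal a := fun k hk => by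
    have hrk : bandwidth d cN N k ^ 2 ≤ cellMassConst d μmin κ :=
      (pow_le_pow_left₀ (bandwidth_pos hcN hB.one_le k).le
        (bandwidth_anti hcN hB.one_le (Nat.zero_le k)) 2).trans hr
    refine (hact.measure_not_isAccurateStep_log_le h hs0 hs hPi hμmin hκ hcN hB.three_le hδ hm
      (hwidth k) hrk).trans (ENNReal.ofReal_le_ofReal ?_)
    have hkN : (stepSize cN N k : ℝ) ≤ (N : ℝ) ^ 2 := by exact_mod_cast (Finset.mem_filter.1 hk).2
    simp only [a]
    gcongr
  calc _ ≤ ∑ k ∈ steps, μ (bad k) := (measure_mono hcover).trans (measure_biUnion_finset_le _ _)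
    _ ≤ steps.card * ENNReal.ofReal a := by
        simpa only [nsmul_eq_mul] using Finset.sum_le_card_nsmul _ _ _ hbad
    _ ≤ (N ^ 2 + 1 : ℕ) * ENNReal.ofReal a := by
        gcongr
        exact (Finset.card_filter_le _ _).trans_eq (Finset.card_range _)
    _ = ENNReal.ofReal (((N : ℝ) ^ 2 + 1) * a) := by
        rw [← ENNReal.ofReal_natCast, ← ENNReal.ofReal_mul (Nat.cast_nonneg _)]
        push_cast
        rfl
    _ ≤ ENNReal.ofReal δ := ENNReal.ofReal_le_ofReal
        (union_bound_log_le (by exact_mod_cast hB.one_le) hδ (by positivity) hκN)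

end Event

section Budget

variable {d N : ℕ} {cN κ : ℝ}

lemma isRefining_of_bandwidth_div_le {m : ℕ → ℕ} (hcN : 1 ≤ cN) (hN : 1 ≤ N) (hκ : 0 < κ)
    (hdvd : ∀ k, m k ∣ m (k + 1)) (hwidth : ∀ k, bandwidth d cN N k / κ ≤ 1 / (m k : ℝ)) :
    IsRefining m where
  pos k := by
    have hpos := (div_pos (bandwidth_pos hcN hN k) hκ).trans_le (hwidth k)
    exact Nat.cast_pos.1 (one_div_pos.1 hpos)
  dvd_succ := hdvd

lemma tendsto_stepSize_zero (cN : ℝ) :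
    Filter.Tendsto (fun N => (stepSize cN N 0 : ℝ)) Filter.atTop Filter.atTop :=
  tendsto_natCast_atTop_atTop.comp
    (Filter.tendsto_atTop_atTop.2 fun n => ⟨n * n, fun _ hn => Nat.le_sqrt.2 hn⟩)

lemma tendsto_bandwidth_zero (d : ℕ) (cN : ℝ) :
    Filter.Tendsto (fun N => bandwidth d cN N 0) Filter.atTop (nhds 0) :=
  (tendsto_rpow_neg_atTop (by positivity)).comp (tendsto_stepSize_zero cN)

lemma eventually_isLargeBudget (hcN : 1 < cN) : ∀ᶠ N in Filter.atTop, IsLargeBudget cN N := by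
  have hstep := (tendsto_stepSize_zero cN).const_mul_atTop (r := (cN - 1) / 2) (by linarith)
  filter_upwards [Filter.eventually_ge_atTop 8, hstep.eventually_ge_atTop 1] with N h8 h1
  exact ⟨h8, h1⟩

lemma exists_forall_ge_isLargeBudget (d : ℕ) (hcN : 1 < cN) (a b : ℝ) {r : ℝ} (hr : 0 < r) :
    ∃ M : ℕ, ∀ N ≥ M, IsLargeBudget cN N ∧ a ≤ Real.log N ∧ b ≤ N ∧
      bandwidth d cN N 0 ^ 2 ≤ r := by
  have hcast := tendsto_natCast_atTop_atTop (R := ℝ)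
  have hlog := Real.tendsto_log_atTop.comp hcast
  have hsq : Filter.Tendsto (fun N => bandwidth d cN N 0 ^ 2) Filter.atTop (nhds 0) := by
    simpa using (tendsto_bandwidth_zero d cN).pow 2
  exact Filter.eventually_atTop.1 ((eventually_isLargeBudget hcN).and
    ((hlog.eventually_ge_atTop a).and
      ((hcast.eventually_ge_atTop b).and (hsq.eventually_le_const hr))))

lemma half_le_log_div {n δ : ℝ} (hn : 1 ≤ n) (hδ0 : 0 < δ) (hδ : δ < 1 / 2) :
    1 / 2 ≤ Real.log (n / δ) := by
  have hle : Real.log 2 ≤ Real.log (n / δ) := by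
    refine Real.log_le_log two_pos ?_
    rw [le_div_iff₀ hδ0]
    linarith
  linarith [Real.log_two_gt_d9]

lemma one_le_mul_log_pow_mul_rpow {M K δ : ℝ} (hd : 1 ≤ d) (hN : 1 ≤ N) (hNM : N ≤ M)
    (hδ0 : 0 < δ) (hδ : δ < 1 / 2) (hK : 32 * M ≤ K) :
    1 ≤ K * Real.log ((N : ℝ) / δ) ^ 5 * (N : ℝ) ^ (-(2 / (1 + (d : ℝ)))) := by
  have hN1 : (1 : ℝ) ≤ N := Nat.one_le_cast.2 hN
  have hlog := half_le_log_div hN1 hδ0 hδ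
  have hrate : (N : ℝ)⁻¹ ≤ (N : ℝ) ^ (-(2 / (1 + (d : ℝ)))) := by
    rw [← Real.rpow_neg_one]
    refine Real.rpow_le_rpow_of_exponent_le hN1 (neg_le_neg ?_)
    rw [div_le_one (by positivity)]
    linarith [Nat.one_le_cast (α := ℝ).2 hd]
  calc (1 : ℝ) = 32 * N * (1 / 2) ^ 5 * (N : ℝ)⁻¹ := by
        field_simp
        norm_num
    _ ≤ K * Real.log ((N : ℝ) / δ) ^ 5 * (N : ℝ) ^ (-(2 / (1 + (d : ℝ)))) := by
        have : 0 ≤ K := by linarith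
        gcongr
        linarith

end Budget

lemma risk_sub_risk_le_one {d : ℕ} {P : Measure ((Fin d → ℝ) × Bool)} [IsProbabilityMeasure P]
    (g g' : (Fin d → ℝ) → Bool) : risk P g - risk P g' ≤ 1 :=
  (sub_le_self _ measureReal_nonneg).trans measureReal_le_one

theorem theorem1_general (d : ℕ) (hd : 1 ≤ d) (s μmin C cN κ : ℝ) (hs : 0 ≤ s) (hμmin : 0 < μmin)
    (hcN : 1 < cN) (hκ : 0 < κ) :
    ∃ (K : ℝ) (p : ℕ), 0 < K ∧
      ∀ (P : Measure ((Fin d → ℝ) × Bool)) [IsProbabilityMeasure P] (η : (Fin d → ℝ) → ℝ),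
        IsRegressionFunction P η →
        IsSmooth s η →
        HasDensityLowerBound μmin P.fst →
        HasBoundedScoreDensity C P.fst (score η) →
      ∀ (N : ℕ) (δ : ℝ) (m : ℕ → ℕ), 1 ≤ N → 0 < δ → δ < 1 / 2 →
        (∀ k, m k ∣ m (k + 1)) →
        (∀ k, bandwidth d cN N k / κ ≤ 1 / (m k : ℝ) ∧
          1 / (m k : ℝ) ≤ κ * bandwidth d cN N k) →
      ∀ {Ω : Type*} [MeasurableSpace Ω] (μ : Measure Ω) [IsProbabilityMeasure μ]
        (Z : ℕ → ℕ → Ω → (Fin d → ℝ) × Bool),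
        IsActiveSample μ P (fun k ω => region P N δ cN m (fun j i => Z j i ω) k) Z →
        ∃ E : Set Ω, MeasurableSet E ∧ ENNReal.ofReal (1 - δ) ≤ μ E ∧
          ∀ ω ∈ E,
            risk P (activeClassifier P N δ cN m (fun j i => Z j i ω)) - risk P (plugIn η) ≤
              K * Real.log ((N : ℝ) / δ) ^ p * (N : ℝ) ^ (-(2 / (1 + (d : ℝ)))) := by
  set c := accuracyConst d s μmin κ
  obtain ⟨M, hM⟩ := exists_forall_ge_isLargeBudget d hcN (3 * C * c) (12 * κ ^ d)
    (cellMassConst_pos (d := d) hμmin hκ)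
  refine ⟨max (2 * C * c ^ 2 * growthConst cN) (32 * (M + 1)), 5,
    lt_max_of_lt_right (by positivity), ?_⟩
  intro P _ η h hsm hPi hC N δ m hN hδ0 hδ hdvd hwidth Ω _ μ _ Z hact
  rcases lt_or_ge N M with hNM | hMN
  · refine ⟨univ, MeasurableSet.univ, by simp [hδ0.le], fun ω _ => (risk_sub_risk_le_one _ _).trans
      (one_le_mul_log_pow_mul_rpow hd hN ?_ hδ0 hδ (le_max_right _ _))⟩
    exact_mod_cast hNM.le.trans M.le_succ
  · have hδ01 : δ ∈ Ioc 0 1 := ⟨hδ0, by linarith⟩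
    have hm := isRefining_of_bandwidth_div_le hcN.le hN hκ hdvd fun k => (hwidth k).1
    obtain ⟨hB, hlog, hκN, hr⟩ := hM N hMN
    obtain ⟨E, hE, hμE, hgood⟩ := exists_measurableSet_compl_of_measure_le hδ0.le
      (hact.measure_exists_not_isAccurateStep_le hB h hs hsm hPi hμmin hκ hδ01 hm hwidth hr hκN)
    refine ⟨E, hE, hμE, fun ω hω => (risk_activeClassifier_sub_le hB hd hδ01 hm h hPi hC
      (accuracyConst_nonneg hs hκ) hlog fun k hk => by_contra fun hacc =>
        hgood ω hω ⟨k, hk, hacc⟩).trans ?_⟩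
    have hℓ := log_div_nonneg (N := N) hδ01
    gcongr
    exact le_max_left _ _

theorem theorem1 (d : ℕ) (hd : 1 ≤ d) (s μmin μmax C cN κ : ℝ) (hs : 0 ≤ s) (hμmin : 0 < μmin)
    (hμmax : 0 < μmax) (hC : 0 < C) (hcN : 1 < cN) (hκ : 1 ≤ κ) :
    ∃ (K : ℝ) (p : ℕ), 0 < K ∧
      ∀ (P : Measure ((Fin d → ℝ) × Bool)) [IsProbabilityMeasure P] (η : (Fin d → ℝ) → ℝ),
        IsRegressionFunction P η →
        IsSmooth s η →
        HasStrongDensity μmin μmax P.fst →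
        HasBoundedScoreDensity C P.fst (score η) →
      ∀ (N : ℕ) (δ : ℝ) (m : ℕ → ℕ), 1 ≤ N → 0 < δ → δ < 1 / 2 →
        (∀ k, m k ∣ m (k + 1)) →
        (∀ k, bandwidth d cN N k / κ ≤ 1 / (m k : ℝ) ∧
          1 / (m k : ℝ) ≤ κ * bandwidth d cN N k) →
      ∀ {Ω : Type*} [MeasurableSpace Ω] (μ : Measure Ω) [IsProbabilityMeasure μ]
        (Z : ℕ → ℕ → Ω → (Fin d → ℝ) × Bool),
        IsActiveSample μ P (fun k ω => region P N δ cN m (fun j i => Z j i ω) k) Z →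
        ∃ E : Set Ω, MeasurableSet E ∧ ENNReal.ofReal (1 - δ) ≤ μ E ∧
          ∀ ω ∈ E,
            risk P (activeClassifier P N δ cN m (fun j i => Z j i ω)) - risk P (plugIn η) ≤
              K * Real.log ((N : ℝ) / δ) ^ p * (N : ℝ) ^ (-(2 / (1 + (d : ℝ)))) := by
  obtain ⟨K, p, hK, hbound⟩ :=
    theorem1_general d hd s μmin C cN κ hs hμmin hcN (one_pos.trans_le hκ)
  exact ⟨K, p, hK, fun P _ η h hsm hPi => hbound P η h hsm hPi.hasDensityLowerBound⟩
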